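/- Let $T>0$, $\Omega=[0,1]\times[0,T]$; all functions are real valued, and derivatives at the boundary of $\Omega$ are one-sided. A function $f$ on $\Omega$ is called completely continuous if $f(\cdot,0)$ and $f(0,\cdot)$ are absolutely continuous and there is $c\in L^1(\Omega)$ with $f(x,t)-f(x,0)-f(0,t)+f(0,0)=\int_0^x\int_0^t c$ for all $(x,t)\in\Omega$; then $\partial^2 f/\partial x\partial t:=c$. Let $W_2^3[0,1]$ be the space of $u$ with $u,u',u''$ absolutely continuous, $u'''\in L^2[0,1]$ and $u(0)=u(1)=0$, with $\langle u,g\rangle_{W_2^3}=u(0)g(0)+u'(0)g'(0)+u'(1)g'(1)+\int_0^1u'''g'''\,dx$, and let $W_2^1[0,1]$ be the space of absolutely continuous $u$ with $u'\in L^2[0,1]$, with $\langle u,g\rangle_{W_2^1}=u(0)g(0)+\int_0^1u'g'\,dx$. Let $W(\Omega)$ be the space of functions $u$ on $\Omega$ whose partial derivatives $\partial_x^i\partial_t^ju$, $0\le i,j\le 2$, exist and are continuous, such that $\partial_x^2\partial_t^2u$ is completely continuous, $\partial_x^3\partial_t^3u\in L^2(\Omega)$, $\partial_t^3\partial_x^iu(0,\cdot)\in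 L^2[0,T]$ and $\partial_t^ju(\cdot,0)\in W_2^3[0,1]$ for $0\le i,j\le2$, and $u(x,0)=\partial_tu(x,0)=0$, $u(0,t)=u(1,t)=0$, with the inner product $$\langle u,g\rangle_W=\sum_{i=0}^2\int_0^T\partial_t^3\partial_x^iu(0,t)\,\partial_t^3\partial_x^ig(0,t)\,dt+\sum_{j=0}^2\langle\partial_t^ju(\cdot,0),\partial_t^jg(\cdot,0)\rangle_{W_2^3}+\int_0^1\!\!\int_0^T\partial_x^3\partial_t^3u\;\partial_x^3\partial_t^3g\,dt\,dx .$$ Let $\widehat W(\Omega)$ be the space of completely continuous $f$ on $\Omega$ with $\partial_x\partial_tf\in L^2(\Omega)$, $\partial_tf(0,\cdot)\in L^2[0,T]$ and $f(\cdot,0)\in W_2^1[0,1]$, with the inner product $$\langle f,g\rangle_{\widehat W}=\int_0^T\partial_tf(0,t)\,\partial_tg(0,t)\,dt+\langle f(\cdot,0),g(\cdot,0)\rangle_{W_2^1}+\int_0^1\!\!\int_0^T\partial_x\partial_tf\;\partial_x\partial_tg\,dt\,dx .$$ Let $Lv=\partial_t^2v-\partial_x^2v$ and $G_{(y,s)}(x,t)=(1+\min(x,y))(1+\min(t,s))$.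 Then $L$ maps $W(\Omega)$ into $\widehat W(\Omega)$ and has an adjoint $L^*:\widehat W(\Omega)\to W(\Omega)$, $W(\Omega)$ has a reproducing kernel $K$ (that is, $K_{(y,s)}\in W(\Omega)$ and $\langle u,K_{(y,s)}\rangle_W=u(y,s)$ for all $(y,s)\in\Omega$, $u\in W(\Omega)$), and $G$ is the reproducing kernel of $\widehat W(\Omega)$. **Theorem 3.1.** Let $(x_i,t_i)_{i\ge1}$ be a sequence of points of $\Omega$ that is dense in $\Omega$, and put $\varphi_i=G_{(x_i,t_i)}$, $\Psi_i=L^*\varphi_i$. Then $\{\Psi_i\}$ is a complete system in $W(\Omega)$: the $\Psi_i$ lie in $W(\Omega)$, their finite linear combinations are dense in $W(\Omega)$, and $u\in W(\Omega)$ with $\langle u,\Psi_i\rangle_W=0$ for all $i$ implies $u=0$. Moreover, for all $i$ and all $(x,t)\in\Omega$, $$\Psi_i(x,t)=L_{(y,s)}K_{(y,s)}(x,t)\Big|_{(y,s)=(x_i,t_i)} .$$ -/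

import Mathlib

open MeasureTheory Set

namespace SineGordonRK

noncomputable section

/-- The closed rectangle `Ω = [0,1] × [0,T]`.  Functions on `Ω` are represented by functions
`ℝ × ℝ → ℝ` of `(x, t)`; every notion below depends only on the values on `Ω`. -/
def rect (T : ℝ) : Set (ℝ × ℝ) := Icc 0 1 ×ˢ Icc 0 T

/-- The partial derivative `∂ₓⁱ ∂ₜʲ u` on `Ω`, one-sided at the boundary of `Ω`. -/
def pd (T : ℝ) (i j : ℕ) (u : ℝ × ℝ → ℝ) (q : ℝ × ℝ) : ℝ :=
  iteratedDerivWithin i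
    (fun x => iteratedDerivWithin j (fun t => u (x, t)) (Icc 0 T) q.2) (Icc 0 1) q.1

/-- `c` is an (integrable) mixed derivative `∂²f/∂x∂t` of `f` on `Ω`: the increments of `f` over
the rectangles `[0,x] × [0,t]` are the integrals of `c`.  Such a `c` is unique almost everywhere
on `Ω`. -/
def HasMixedDeriv (T : ℝ) (f c : ℝ × ℝ → ℝ) : Prop :=
  IntegrableOn c (rect T) ∧
    ∀ x ∈ Icc (0 : ℝ) 1, ∀ t ∈ Icc (0 : ℝ) T,
      f (x, t) - f (x, 0) - f (0, t) + f (0, 0) = ∫ q in Icc 0 x ×ˢ Icc 0 t, c q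

/-- `f` is completely (that is, absolutely) continuous on `Ω` in the sense of Carathéodory:
absolutely continuous along the two edges through the origin, with rectangle increments that are
the integrals of an integrable function. -/
def CompletelyContinuous (T : ℝ) (f : ℝ × ℝ → ℝ) : Prop :=
  AbsolutelyContinuousOnInterval (fun x => f (x, 0)) 0 1 ∧
    AbsolutelyContinuousOnInterval (fun t => f (0, t)) 0 T ∧
    ∃ c, HasMixedDeriv T f c

open Classical in
/-- The mixed derivative `∂²f/∂x∂t` of a completely continuous function, determined almost
everywhere on `Ω`. -/
def mixedDeriv (T : ℝ) (f : ℝ × ℝ → ℝ) : ℝ × ℝ → ℝ :=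
  if h : ∃ c, HasMixedDeriv T f c then h.choose else 0

/-- The space `W₂³[0,1]`, with the boundary conditions `u(0) = u(1) = 0`. -/
def W23 : Set (ℝ → ℝ) :=
  {u | (∀ k ≤ 2, AbsolutelyContinuousOnInterval (iteratedDerivWithin k u (Icc 0 1)) 0 1) ∧
    MemLp (iteratedDerivWithin 3 u (Icc 0 1)) 2 (volume.restrict (Icc 0 1)) ∧
    u 0 = 0 ∧ u 1 = 0}

/-- The inner product of `W₂³[0,1]`. -/
def innerW23 (u g : ℝ → ℝ) : ℝ :=
  u 0 * g 0 + derivWithin u (Icc 0 1) 0 * derivWithin g (Icc 0 1) 0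
    + derivWithin u (Icc 0 1) 1 * derivWithin g (Icc 0 1) 1
    + ∫ x in (0 : ℝ)..1,
        iteratedDerivWithin 3 u (Icc 0 1) x * iteratedDerivWithin 3 g (Icc 0 1) x

/-- The space `W₂¹[0,1]`. -/
def W21 : Set (ℝ → ℝ) :=
  {u | AbsolutelyContinuousOnInterval u 0 1 ∧
    MemLp (derivWithin u (Icc 0 1)) 2 (volume.restrict (Icc 0 1))}

/-- The inner product of `W₂¹[0,1]`. -/
def innerW21 (u g : ℝ → ℝ) : ℝ :=
  u 0 * g 0 + ∫ x in (0 : ℝ)..1, derivWithin u (Icc 0 1) x * derivWithin g (Icc 0 1) x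

/-- The derivative of `f` in `t` along the edge `x = 0`, that is `t ↦ (∂f/∂t)(0,t)`. -/
def edgeDeriv (T : ℝ) (f : ℝ × ℝ → ℝ) (t : ℝ) : ℝ :=
  derivWithin (fun τ => f (0, τ)) (Icc 0 T) t

/-- The space `W(Ω)`: the partial derivatives `∂ₓⁱ∂ₜʲu`, `i, j ≤ 2`, exist and are continuous,
`∂ₓ²∂ₜ²u` is completely continuous, `∂ₓ³∂ₜ³u` is square integrable, the one-dimensional traces that
enter the inner product lie in the spaces in which it is taken, and `u` satisfies the
homogeneous initial and boundary conditions. -/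
structure MemW (T : ℝ) (u : ℝ × ℝ → ℝ) : Prop where
  contDiff_t : ∀ x ∈ Icc (0 : ℝ) 1, ContDiffOn ℝ 2 (fun t => u (x, t)) (Icc 0 T)
  contDiff_x : ∀ j ≤ 2, ∀ t ∈ Icc (0 : ℝ) T,
    ContDiffOn ℝ 2 (fun x => pd T 0 j u (x, t)) (Icc 0 1)
  continuous_pd : ∀ i ≤ 2, ∀ j ≤ 2, ContinuousOn (pd T i j u) (rect T)
  completelyContinuous : CompletelyContinuous T (pd T 2 2 u)
  memLp_mixed : MemLp (mixedDeriv T (pd T 2 2 u)) 2 (volume.restrict (rect T))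
  memLp_edge : ∀ i ≤ 2, MemLp (edgeDeriv T (pd T i 2 u)) 2 (volume.restrict (Icc 0 T))
  trace_mem : ∀ j ≤ 2, (fun x => pd T 0 j u (x, 0)) ∈ W23
  initial : ∀ x ∈ Icc (0 : ℝ) 1, u (x, 0) = 0
  initial_deriv : ∀ x ∈ Icc (0 : ℝ) 1, pd T 0 1 u (x, 0) = 0
  boundary_left : ∀ t ∈ Icc (0 : ℝ) T, u (0, t) = 0
  boundary_right : ∀ t ∈ Icc (0 : ℝ) T, u (1, t) = 0

/-- The space `W(Ω)` as a set of functions. -/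
def W (T : ℝ) : Set (ℝ × ℝ → ℝ) := {u | MemW T u}

/-- The inner product of `W(Ω)`:
`∑_{i ≤ 2} ∫₀ᵀ ∂ₜ³∂ₓⁱu(0,t) ∂ₜ³∂ₓⁱg(0,t) dt + ∑_{j ≤ 2} ⟨∂ₜʲu(·,0), ∂ₜʲg(·,0)⟩`
plus `∫∫ ∂ₓ³∂ₜ³u ∂ₓ³∂ₜ³g`. -/
def innerW (T : ℝ) (u g : ℝ × ℝ → ℝ) : ℝ :=
  (∑ i ∈ Finset.range 3,
      ∫ t in (0 : ℝ)..T, edgeDeriv T (pd T i 2 u) t * edgeDeriv T (pd T i 2 g) t)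
    + (∑ j ∈ Finset.range 3,
      innerW23 (fun x => pd T 0 j u (x, 0)) (fun x => pd T 0 j g (x, 0)))
    + ∫ q in rect T, mixedDeriv T (pd T 2 2 u) q * mixedDeriv T (pd T 2 2 g) q

/-- The space `Ŵ(Ω)`: completely continuous functions with square integrable mixed derivative,
whose one-dimensional traces lie in the spaces in which the inner product is taken. -/
structure MemWhat (T : ℝ) (f : ℝ × ℝ → ℝ) : Prop where
  completelyContinuous : CompletelyContinuous T f
  memLp_mixed : MemLp (mixedDeriv T f) 2 (volume.restrict (rect T))
  memLp_edge : MemLp (edgeDeriv T f) 2 (volume.restrict (Icc 0 T))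
  trace_mem : (fun x => f (x, 0)) ∈ W21

/-- The space `Ŵ(Ω)` as a set of functions. -/
def What (T : ℝ) : Set (ℝ × ℝ → ℝ) := {f | MemWhat T f}

/-- The inner product of `Ŵ(Ω)`. -/
def innerWhat (T : ℝ) (f g : ℝ × ℝ → ℝ) : ℝ :=
  (∫ t in (0 : ℝ)..T, edgeDeriv T f t * edgeDeriv T g t)
    + innerW21 (fun x => f (x, 0)) (fun x => g (x, 0))
    + ∫ q in rect T, mixedDeriv T f q * mixedDeriv T g q

/-- `K` (with `K z = K_z`, a function on `Ω` for each `z ∈ Ω`) is the reproducing kernel on `Ω` of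
the space `V` with inner product `ip`. -/
def IsReproducingKernel (Ω : Set (ℝ × ℝ)) (V : Set (ℝ × ℝ → ℝ))
    (ip : (ℝ × ℝ → ℝ) → (ℝ × ℝ → ℝ) → ℝ) (K : ℝ × ℝ → ℝ × ℝ → ℝ) : Prop :=
  (∀ z ∈ Ω, K z ∈ V) ∧ ∀ z ∈ Ω, ∀ f ∈ V, ip f (K z) = f z

/-- The one-dimensional kernel `1 + min`: both `Q_y(x)` on `[0,1]` and `q_s(t)` on `[0,T]`. -/
def kernel1 (y x : ℝ) : ℝ := if x ≤ y then 1 + x else 1 + y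

/-- The kernel `G_{(y,s)}(x,t) = Q_y(x) q_s(t)`. -/
def G (z q : ℝ × ℝ) : ℝ := kernel1 z.1 q.1 * kernel1 z.2 q.2

/-- The wave operator `Lv = ∂²v/∂t² - ∂²v/∂x²`. -/
def waveOp (T : ℝ) (v : ℝ × ℝ → ℝ) (q : ℝ × ℝ) : ℝ := pd T 0 2 v q - pd T 2 0 v q

/-- `Ladj` is the adjoint `L* : Ŵ(Ω) → W(Ω)` of `L : W(Ω) → Ŵ(Ω)`. -/
def IsAdjoint (T : ℝ) (Ladj : (ℝ × ℝ → ℝ) → (ℝ × ℝ → ℝ)) : Prop :=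
  (∀ f ∈ What T, Ladj f ∈ W T) ∧
    ∀ u ∈ W T, ∀ f ∈ What T, innerWhat T (waveOp T u) f = innerW T u (Ladj f)

/-- `Ψ` is a complete system in `W(Ω)`: its members lie in `W(Ω)`, their finite linear combinations
are dense in `W(Ω)` for the norm `√⟨u,u⟩`, and only the zero function of `W(Ω)` is orthogonal to
all of them. -/
def IsCompleteSystem (T : ℝ) (Ψ : ℕ → ℝ × ℝ → ℝ) : Prop :=
  (∀ i, Ψ i ∈ W T) ∧
    (∀ u ∈ W T, ∀ ε > 0, ∃ v ∈ Submodule.span ℝ (range Ψ), √(innerW T (u - v) (u - v)) < ε) ∧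
    ∀ u ∈ W T, (∀ i, innerW T u (Ψ i) = 0) → ∀ q ∈ rect T, u q = 0

end

end SineGordonRK

namespace SineGordonRK

/-! ### Absolutely continuous functions of one variable -/

/-! Since `G` reproduces `Ŵ(Ω)`, `⟨u, Ψ_i⟩ = ⟨Lu, G_{p i}⟩ = (Lu)(p i)` for every `u` in `W(Ω)`. If
`u` is orthogonal to all `Ψ_i`, then `Lu`, which is continuous, vanishes on a dense set and hence on
`Ω`. The energy argument for the wave equation with zero initial and Dirichlet data gives `u = 0`
(`solve_eq_zero_of_waveOp`). Density of the span then follows by Hilbert space duality, and `u =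
K_q` together with the symmetry of `K` gives the formula for `Ψ_i`.

The remaining work makes the two spaces into usable Hilbert spaces. A function of `Ŵ(Ω)` is
determined on `Ω` by its value at the origin, its two edge derivatives and its mixed derivative, so
`Ŵ(Ω)` is isometric to `Data T`, a product of `ℝ` and three `L²` spaces. Evaluation at a point is
there the inner product with indicator functions (`Data.innerWhat_toFun`, `Data.inner_eval`).

A function `u` of `W(Ω)` is recovered from `w = ∂ₓ²∂ₜ²u`, an element of `Ŵ(Ω)`, as `solve w`: two
primitives in `t` and the Dirichlet Green operator in `x` (`memW_iff`). All operators involved are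
built from primitives and the trace at `x = 1`; these preserve `Ŵ(Ω)` and are bounded by the closed
graph theorem. In terms of `w` the inner product of `W(Ω)` is a bounded symmetric coercive form on
`Data T` (`isCoercive_formW`), so Lax–Milgram supplies the adjoint of `L`, the kernel `K` and the
density statement. -/

theorem absolutelyContinuous_congr {f g : ℝ → ℝ} {a b : ℝ}
    (hf : AbsolutelyContinuousOnInterval f a b) (h : EqOn f g (uIcc a b)) :
    AbsolutelyContinuousOnInterval g a b := by
  rw [absolutelyContinuousOnInterval_iff] at hf ⊢
  intro ε hε
  obtain ⟨δ, hδ, H⟩ := hf ε hε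
  refine ⟨δ, hδ, fun E hE hs => ?_⟩
  convert H E hE hs using 1
  refine Finset.sum_congr rfl fun i hi => ?_
  have := hE.1 i hi
  rw [h this.1, h this.2]

theorem derivWithin_Icc_ae_eq_deriv (f : ℝ → ℝ) (a : ℝ) :
    derivWithin f (Icc 0 a) =ᵐ[volume.restrict (Icc 0 a)] deriv f := by
  rw [← Measure.restrict_congr_set (Ioo_ae_eq_Icc (μ := volume) (a := (0 : ℝ)) (b := a))]
  filter_upwards [ae_restrict_mem measurableSet_Ioo] with x hx
  exact derivWithin_of_mem_nhds (Icc_mem_nhds hx.1 hx.2)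

theorem integral_congr_Icc {f g : ℝ → ℝ} {a x : ℝ} (hx : x ∈ Icc 0 a)
    (h : f =ᵐ[volume.restrict (Icc 0 a)] g) : ∫ r in (0 : ℝ)..x, f r = ∫ r in (0 : ℝ)..x, g r := by
  refine intervalIntegral.integral_congr_ae_restrict ?_
  refine ae_restrict_of_ae_restrict_of_subset ?_ h
  rw [uIoc_of_le hx.1]
  exact Ioc_subset_Icc_self.trans (Icc_subset_Icc_right hx.2)

theorem intervalIntegrable_of_Icc {f : ℝ → ℝ} {a x : ℝ} (hx : x ∈ Icc 0 a)
    (h : IntegrableOn f (Icc 0 a)) : IntervalIntegrable f volume 0 x := by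
  rw [intervalIntegrable_iff, uIoc_of_le hx.1]
  exact h.mono_set (Ioc_subset_Icc_self.trans (Icc_subset_Icc_right hx.2))

theorem eq_integral_derivWithin {f : ℝ → ℝ} {a : ℝ}
    (hf : AbsolutelyContinuousOnInterval f 0 a) {x : ℝ} (hx : x ∈ Icc 0 a) :
    f x = f 0 + ∫ r in (0 : ℝ)..x, derivWithin f (Icc 0 a) r := by
  rw [integral_congr_Icc hx (derivWithin_Icc_ae_eq_deriv f a),
    (hf.mono (c := 0) (d := x) ?_).integral_deriv_eq_sub]
  · ring
  · rw [uIcc_of_le hx.1, uIcc_of_le (hx.1.trans hx.2)]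
    exact Icc_subset_Icc_right hx.2

theorem absolutelyContinuous_of_eq_integral {f α : ℝ → ℝ} {a a₀ : ℝ} (ha : 0 ≤ a)
    (hα : IntegrableOn α (Icc 0 a)) (hf : ∀ x ∈ Icc 0 a, f x = a₀ + ∫ r in (0 : ℝ)..x, α r) :
    AbsolutelyContinuousOnInterval f 0 a := by
  have hi := intervalIntegrable_of_Icc (right_mem_Icc.2 ha) hα
  have h1 := hi.absolutelyContinuousOnInterval_intervalIntegral (c := 0) (by simp)
  have h2 : AbsolutelyContinuousOnInterval (fun _ : ℝ => a₀) 0 a := by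
    simpa [AbsolutelyContinuousOnInterval] using tendsto_const_nhds
  refine absolutelyContinuous_congr (h2.add h1) fun x hx => ?_
  rw [uIcc_of_le ha] at hx
  simp [hf x hx]

/-- Lebesgue differentiation at interior points; the two endpoints form a null set. -/
theorem derivWithin_ae_eq_of_eq_integral {f α : ℝ → ℝ} {a a₀ : ℝ} (ha : 0 ≤ a)
    (hα : IntegrableOn α (Icc 0 a)) (hf : ∀ x ∈ Icc 0 a, f x = a₀ + ∫ r in (0 : ℝ)..x, α r) :
    derivWithin f (Icc 0 a) =ᵐ[volume.restrict (Icc 0 a)] α := by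
  have hi := intervalIntegrable_of_Icc (right_mem_Icc.2 ha) hα
  refine (derivWithin_Icc_ae_eq_deriv f a).trans ?_
  rw [← Measure.restrict_congr_set (Ioo_ae_eq_Icc (μ := volume) (a := (0 : ℝ)) (b := a))]
  filter_upwards [ae_restrict_mem measurableSet_Ioo, ae_restrict_of_ae hi.ae_hasDerivAt_integral]
    with x hx h
  rw [uIcc_of_le ha] at h
  have h1 := (h (Ioo_subset_Icc_self hx) 0 (left_mem_Icc.2 ha)).const_add a₀
  refine (h1.congr_of_eventuallyEq ?_).deriv
  filter_upwards [Icc_mem_nhds hx.1 hx.2] with y hy using hf y hy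

/-! ### Uniqueness of the mixed derivative -/

theorem generateFrom_Iic_prod_Iic :
    (inferInstance : MeasurableSpace (ℝ × ℝ)) =
      MeasurableSpace.generateFrom (image2 (· ×ˢ ·) (range (Iic : ℝ → Set ℝ)) (range Iic)) := by
  have hs : IsCountablySpanning (range (Iic : ℝ → Set ℝ)) := by
    refine ⟨fun n : ℕ => Iic (n : ℝ), fun n => ⟨_, rfl⟩, ?_⟩
    rw [eq_univ_iff_forall]
    intro x
    obtain ⟨n, hn⟩ := exists_nat_ge x
    exact mem_iUnion.2 ⟨n, hn⟩
  have hg : MeasurableSpace.generateFrom (range (Iic : ℝ → Set ℝ)) = borel ℝ :=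
    (borel_eq_generateFrom_Iic ℝ).symm
  have := generateFrom_eq_prod (C := range (Iic : ℝ → Set ℝ)) (D := range (Iic : ℝ → Set ℝ))
    (hg.trans (BorelSpace.measurable_eq (α := ℝ)).symm)
    (hg.trans (BorelSpace.measurable_eq (α := ℝ)).symm) hs hs
  exact this.symm

/-- The sets `Iic x ×ˢ Iic t` are a π-system generating the Borel sets of the plane, and each meets
the rectangle in a corner rectangle at the origin or not at all. By the π-λ theorem the integral of
`c` over every measurable set vanishes. -/
theorem ae_eq_zero_of_integral_corner_eq_zero {a b : ℝ} (ha : 0 ≤ a) (hb : 0 ≤ b)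
    {c : ℝ × ℝ → ℝ} (hc : IntegrableOn c (Icc 0 a ×ˢ Icc 0 b))
    (h : ∀ x ∈ Icc 0 a, ∀ t ∈ Icc 0 b, ∫ q in Icc 0 x ×ˢ Icc 0 t, c q = 0) :
    c =ᵐ[volume.restrict (Icc 0 a ×ˢ Icc 0 b)] 0 := by
  set μ := volume.restrict (Icc (0 : ℝ) a ×ˢ Icc (0 : ℝ) b) with hμ
  have hc' : Integrable c μ := hc
  have htot : ∫ q, c q ∂μ = 0 := h a (right_mem_Icc.2 ha) b (right_mem_Icc.2 hb)
  have key : ∀ s : Set (ℝ × ℝ), MeasurableSet s → ∫ q in s, c q ∂μ = 0 := by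
    intro s hs
    induction s, hs using MeasurableSpace.induction_on_inter generateFrom_Iic_prod_Iic
      (isPiSystem_Iic.prod isPiSystem_Iic) with
    | empty => simp
    | basic s hs =>
      obtain ⟨_, ⟨x, rfl⟩, _, ⟨t, rfl⟩, rfl⟩ := hs
      simp only
      rw [hμ, Measure.restrict_restrict (measurableSet_Iic.prod measurableSet_Iic), prod_inter_prod]
      have e : ∀ x a : ℝ, Iic x ∩ Icc 0 a = Icc 0 (min x a) := by
        intro x a; ext y; simp; tauto
      rw [e, e]
      by_cases hx : 0 ≤ x
      · by_cases ht : 0 ≤ t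
        · exact h _ ⟨le_min hx ha, min_le_right _ _⟩ _ ⟨le_min ht hb, min_le_right _ _⟩
        · rw [Icc_eq_empty (b := min t b) (by simp; intro h; exact absurd h ht)]; simp
      · rw [Icc_eq_empty (b := min x a) (by simp; intro h; exact absurd h hx)]; simp
    | compl s hs ih => rw [setIntegral_compl hs hc', htot, ih, sub_zero]
    | iUnion f hd hf ih =>
      rw [integral_iUnion hf hd hc'.integrableOn]
      simp [ih]
  exact hc'.ae_eq_zero_of_forall_setIntegral_eq_zero fun s hs _ => key s hs

/-! ### Representation of completely continuous functions by their derivatives -/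

/-- `f` is the function on `[0,a] × [0,b]` with the square integrable derivatives `α` along the
edge `t = 0`, `β` along the edge `x = 0` and mixed derivative `c`, and with `f (0, 0) = a₀`. -/
structure Rep (a b : ℝ) (f : ℝ × ℝ → ℝ) (a₀ : ℝ) (α β : ℝ → ℝ) (c : ℝ × ℝ → ℝ) : Prop where
  left : MemLp α 2 (volume.restrict (Icc 0 a))
  right : MemLp β 2 (volume.restrict (Icc 0 b))
  mixed : MemLp c 2 (volume.restrict (Icc 0 a ×ˢ Icc 0 b))
  eq : ∀ x ∈ Icc 0 a, ∀ t ∈ Icc 0 b, f (x, t) =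
    a₀ + (∫ r in (0 : ℝ)..x, α r) + (∫ s in (0 : ℝ)..t, β s) + ∫ q in Icc 0 x ×ˢ Icc 0 t, c q

instance (a b : ℝ) : IsFiniteMeasure (volume.restrict (Icc (0 : ℝ) a ×ˢ Icc (0 : ℝ) b)) :=
  isFiniteMeasure_restrict.2 (isCompact_Icc.prod isCompact_Icc).measure_lt_top.ne

instance (T : ℝ) : IsFiniteMeasure (volume.restrict (rect T)) :=
  inferInstanceAs (IsFiniteMeasure (volume.restrict (Icc (0 : ℝ) 1 ×ˢ Icc (0 : ℝ) T)))

theorem integral_corner_left (c : ℝ × ℝ → ℝ) (t : ℝ) :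
    ∫ q in Icc (0 : ℝ) 0 ×ˢ Icc (0 : ℝ) t, c q = 0 := by
  refine setIntegral_measure_zero _ ?_
  rw [Measure.volume_eq_prod, Measure.prod_prod]
  simp

theorem integral_corner_right (c : ℝ × ℝ → ℝ) (x : ℝ) :
    ∫ q in Icc (0 : ℝ) x ×ˢ Icc (0 : ℝ) 0, c q = 0 := by
  refine setIntegral_measure_zero _ ?_
  rw [Measure.volume_eq_prod, Measure.prod_prod]
  simp

namespace Rep

variable {a b a₀ : ℝ} {f : ℝ × ℝ → ℝ} {α β : ℝ → ℝ} {c : ℝ × ℝ → ℝ}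

theorem integrableOn_left (h : Rep a b f a₀ α β c) : IntegrableOn α (Icc 0 a) :=
  h.left.integrable (by norm_num)

theorem integrableOn_right (h : Rep a b f a₀ α β c) : IntegrableOn β (Icc 0 b) :=
  h.right.integrable (by norm_num)

theorem integrableOn_mixed (h : Rep a b f a₀ α β c) : IntegrableOn c (Icc 0 a ×ˢ Icc 0 b) :=
  h.mixed.integrable (by norm_num)

theorem eq_edge_t (h : Rep a b f a₀ α β c) (ha : 0 ≤ a) {t : ℝ} (ht : t ∈ Icc 0 b) :
    f (0, t) = a₀ + ∫ s in (0 : ℝ)..t, β s := by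
  rw [h.eq 0 (left_mem_Icc.2 ha) t ht, integral_corner_left]
  simp

theorem eq_edge_x (h : Rep a b f a₀ α β c) (hb : 0 ≤ b) {x : ℝ} (hx : x ∈ Icc 0 a) :
    f (x, 0) = a₀ + ∫ r in (0 : ℝ)..x, α r := by
  rw [h.eq x hx 0 (left_mem_Icc.2 hb), integral_corner_right]
  simp

theorem eq_zero (h : Rep a b f a₀ α β c) (ha : 0 ≤ a) (hb : 0 ≤ b) : f (0, 0) = a₀ := by
  rw [h.eq_edge_x hb (left_mem_Icc.2 ha)]
  simp

theorem congr {g : ℝ × ℝ → ℝ} (h : Rep a b f a₀ α β c) (hg : EqOn f g (Icc 0 a ×ˢ Icc 0 b)) :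
    Rep a b g a₀ α β c :=
  ⟨h.left, h.right, h.mixed, fun x hx t ht => by rw [← hg ⟨hx, ht⟩, h.eq x hx t ht]⟩

theorem swap (h : Rep a b f a₀ α β c) :
    Rep b a (f ∘ Prod.swap) a₀ β α (c ∘ Prod.swap) := by
  refine ⟨h.right, h.left, ?_, fun x hx t ht => ?_⟩
  · refine h.mixed.comp_measurePreserving ?_
    rw [Measure.volume_eq_prod, ← Measure.prod_restrict, ← Measure.prod_restrict]
    exact Measure.measurePreserving_swap
  · have e := setIntegral_prod_swap (μ := volume) (ν := volume) (Icc 0 x) (Icc 0 t)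
      (c ∘ Prod.swap)
    simp only [Function.comp_apply, Prod.swap_swap] at e
    rw [Measure.volume_eq_prod]
    simp only [Function.comp_apply, Prod.swap_prod_mk, h.eq t ht x hx]
    rw [← e, Measure.volume_eq_prod]
    ring

end Rep

variable {T : ℝ}

theorem MemWhat.rep {f : ℝ × ℝ → ℝ} (hf : MemWhat T f) :
    Rep 1 T f (f (0, 0)) (derivWithin (fun x => f (x, 0)) (Icc 0 1)) (edgeDeriv T f)
      (mixedDeriv T f) := by
  obtain ⟨h1, h2, h3⟩ := hf.completelyContinuous
  refine ⟨hf.trace_mem.2, hf.memLp_edge, hf.memLp_mixed, fun x hx t ht => ?_⟩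
  have hm : HasMixedDeriv T f (mixedDeriv T f) := by
    rw [mixedDeriv, dif_pos h3]
    exact h3.choose_spec
  have e1 := eq_integral_derivWithin h1 hx
  have e2 := eq_integral_derivWithin h2 ht
  have e3 := hm.2 x hx t ht
  simp only [edgeDeriv]
  linarith

namespace Rep

variable {a₀ : ℝ} {f : ℝ × ℝ → ℝ} {α β : ℝ → ℝ} {c : ℝ × ℝ → ℝ}

theorem hasMixedDeriv (hT : 0 ≤ T) (h : Rep 1 T f a₀ α β c) : HasMixedDeriv T f c := by
  refine ⟨h.integrableOn_mixed, fun x hx t ht => ?_⟩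
  rw [h.eq_edge_t zero_le_one ht, h.eq_edge_x hT hx, h.eq x hx t ht, h.eq_zero zero_le_one hT]
  ring

/-- `mixedDeriv` is picked by choice; this makes the choice harmless, since any integrable `c` with
the same rectangle increments agrees with it almost everywhere. -/
theorem mixedDeriv_ae_eq (hT : 0 ≤ T) (h : Rep 1 T f a₀ α β c) :
    mixedDeriv T f =ᵐ[volume.restrict (rect T)] c := by
  have hc := h.hasMixedDeriv hT
  have hm : HasMixedDeriv T f (mixedDeriv T f) := by
    have h3 : ∃ c, HasMixedDeriv T f c := ⟨c, hc⟩
    rw [mixedDeriv, dif_pos h3]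
    exact h3.choose_spec
  have h0 : mixedDeriv T f - c =ᵐ[volume.restrict (rect T)] 0 := by
    refine ae_eq_zero_of_integral_corner_eq_zero zero_le_one hT (hm.1.sub hc.1) ?_
    intro x hx t ht
    have hs : Icc (0 : ℝ) x ×ˢ Icc (0 : ℝ) t ⊆ rect T :=
      prod_mono (Icc_subset_Icc_right hx.2) (Icc_subset_Icc_right ht.2)
    have := integral_sub (hm.1.mono_set hs) (hc.1.mono_set hs)
    simp only [Pi.sub_apply]
    rw [this, ← hm.2 x hx t ht, ← hc.2 x hx t ht, sub_self]
  filter_upwards [h0] with q hq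
  simpa [sub_eq_zero] using hq

theorem edgeDeriv_ae_eq (hT : 0 ≤ T) (h : Rep 1 T f a₀ α β c) :
    edgeDeriv T f =ᵐ[volume.restrict (Icc 0 T)] β :=
  derivWithin_ae_eq_of_eq_integral hT h.integrableOn_right fun _ ht => h.eq_edge_t zero_le_one ht

theorem derivWithin_ae_eq (hT : 0 ≤ T) (h : Rep 1 T f a₀ α β c) :
    derivWithin (fun x => f (x, 0)) (Icc 0 1) =ᵐ[volume.restrict (Icc 0 1)] α :=
  derivWithin_ae_eq_of_eq_integral zero_le_one h.integrableOn_left fun _ hx => h.eq_edge_x hT hx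

theorem memWhat (hT : 0 ≤ T) (h : Rep 1 T f a₀ α β c) : MemWhat T f where
  completelyContinuous := ⟨absolutelyContinuous_of_eq_integral zero_le_one h.integrableOn_left
      fun _ hx => h.eq_edge_x hT hx,
    absolutelyContinuous_of_eq_integral hT h.integrableOn_right
      fun _ ht => h.eq_edge_t zero_le_one ht, c, h.hasMixedDeriv hT⟩
  memLp_mixed := (memLp_congr_ae (h.mixedDeriv_ae_eq hT)).2 h.mixed
  memLp_edge := (memLp_congr_ae (h.edgeDeriv_ae_eq hT)).2 h.right
  trace_mem := ⟨absolutelyContinuous_of_eq_integral zero_le_one h.integrableOn_left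
      fun _ hx => h.eq_edge_x hT hx, (memLp_congr_ae (h.derivWithin_ae_eq hT)).2 h.left⟩

theorem innerWhat_eq (hT : 0 ≤ T) (h : Rep 1 T f a₀ α β c) {a₀' : ℝ} {f' : ℝ × ℝ → ℝ}
    {α' β' : ℝ → ℝ} {c' : ℝ × ℝ → ℝ} (h' : Rep 1 T f' a₀' α' β' c') :
    innerWhat T f f' = a₀ * a₀' + (∫ x in Icc 0 1, α x * α' x) + (∫ t in Icc 0 T, β t * β' t)
      + ∫ q in rect T, c q * c' q := by
  have e1 : ∫ x in Icc 0 1, derivWithin (fun x => f (x, 0)) (Icc 0 1) x *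
      derivWithin (fun x => f' (x, 0)) (Icc 0 1) x = ∫ x in Icc 0 1, α x * α' x :=
    integral_congr_ae ((h.derivWithin_ae_eq hT).mul (h'.derivWithin_ae_eq hT))
  have e2 : ∫ t in Icc 0 T, edgeDeriv T f t * edgeDeriv T f' t = ∫ t in Icc 0 T, β t * β' t :=
    integral_congr_ae ((h.edgeDeriv_ae_eq hT).mul (h'.edgeDeriv_ae_eq hT))
  have e3 : ∫ q in rect T, mixedDeriv T f q * mixedDeriv T f' q = ∫ q in rect T, c q * c' q :=
    integral_congr_ae ((h.mixedDeriv_ae_eq hT).mul (h'.mixedDeriv_ae_eq hT))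
  rw [innerWhat, innerW21, intervalIntegral.integral_of_le hT,
    intervalIntegral.integral_of_le zero_le_one, ← integral_Icc_eq_integral_Ioc,
    ← integral_Icc_eq_integral_Ioc, e1, e2, e3, h.eq_zero zero_le_one hT,
    h'.eq_zero zero_le_one hT]
  ring

end Rep

/-- A `Rep` only sees values on the rectangle, so membership in `Ŵ(Ω)` does too. -/
theorem MemWhat.congr (hT : 0 ≤ T) {f g : ℝ × ℝ → ℝ} (hf : MemWhat T f)
    (h : EqOn f g (rect T)) : MemWhat T g :=
  ((hf.rep).congr h).memWhat hT

/-! ### Partial integrals of square integrable functions -/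

open scoped ENNReal in
-- Cauchy–Schwarz against the constant `1`.
theorem lintegral_enorm_sq_le {X : Type*} [MeasurableSpace X] (μ : Measure X) {f : X → ℝ}
    (hf : AEStronglyMeasurable f μ) :
    (∫⁻ x, ‖f x‖ₑ ∂μ) ^ (2 : ℝ) ≤ μ univ * ∫⁻ x, ‖f x‖ₑ ^ (2 : ℝ) ∂μ := by
  have h := eLpNorm_le_eLpNorm_mul_rpow_measure_univ (p := 1) (q := 2) (by norm_num) hf
  rw [eLpNorm_one_eq_lintegral_enorm,
    eLpNorm_eq_lintegral_rpow_enorm_toReal (by norm_num) (by norm_num)] at h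
  have h2 := ENNReal.rpow_le_rpow h (zero_le_two : (0 : ℝ) ≤ 2)
  refine h2.trans (le_of_eq ?_)
  rw [ENNReal.mul_rpow_of_nonneg _ _ zero_le_two, ← ENNReal.rpow_mul, ← ENNReal.rpow_mul, mul_comm]
  norm_num

section partialIntegral

variable {X : Type*} [MeasurableSpace X] {π : Measure X} {μ ν : Measure ℝ}
  [IsFiniteMeasure μ] [IsFiniteMeasure ν] {σ : X → ℝ} {k : ENNReal}

/-- Cauchy–Schwarz in `ρ`, then Tonelli. The parameters `σ`, `A` and `k` cover two uses at once: the
integral over a full horizontal line as a function of `s`, and the integral up to the moving bound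
`q.1` as a function of `q`. -/
theorem memLp_partial_integral_of_stronglyMeasurable (hσ : Measurable σ) (hk : k ≠ ⊤)
    (hmap : π.map σ = k • ν) {A : Set (X × ℝ)} (hA : MeasurableSet A) {c : ℝ × ℝ → ℝ}
    (hcm : StronglyMeasurable c) (hc : MemLp c 2 (μ.prod ν)) :
    MemLp (fun x => ∫ ρ, A.indicator (fun p => c (p.2, σ p.1)) (x, ρ) ∂μ) 2 π := by
  have hm : StronglyMeasurable (A.indicator fun p : X × ℝ => c (p.2, σ p.1)) :=
    (hcm.comp_measurable (measurable_snd.prodMk (hσ.comp measurable_fst))).indicator hA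
  refine ⟨(hm.integral_prod_right' (ν := μ)).aestronglyMeasurable, ?_⟩
  rw [eLpNorm_lt_top_iff_lintegral_rpow_enorm_lt_top (by norm_num) (by norm_num)]
  have hc2 := (eLpNorm_lt_top_iff_lintegral_rpow_enorm_lt_top (by norm_num) (by norm_num)).1 hc.2
  simp only [ENNReal.toReal_ofNat] at hc2 ⊢
  have hN : Measurable fun s => ∫⁻ ρ, ‖c (ρ, s)‖ₑ ^ (2 : ℝ) ∂μ :=
    (hcm.enorm.pow_const 2).lintegral_prod_left'
  calc ∫⁻ x, ‖∫ ρ, A.indicator (fun p => c (p.2, σ p.1)) (x, ρ) ∂μ‖ₑ ^ (2 : ℝ) ∂π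
      ≤ ∫⁻ x, μ univ * ∫⁻ ρ, ‖c (ρ, σ x)‖ₑ ^ (2 : ℝ) ∂μ ∂π := by
        refine lintegral_mono fun x => ?_
        refine (ENNReal.rpow_le_rpow ((enorm_integral_le_lintegral_enorm _).trans
          (lintegral_mono (g := fun ρ => ‖c (ρ, σ x)‖ₑ) fun ρ => ?_)) zero_le_two).trans
          (lintegral_enorm_sq_le μ ?_)
        · by_cases h : (x, ρ) ∈ A <;> simp [h]
        · exact (hcm.comp_measurable measurable_prodMk_right).aestronglyMeasurable
    _ = μ univ * (k * ∫⁻ q, ‖c q‖ₑ ^ (2 : ℝ) ∂(μ.prod ν)) := by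
        rw [lintegral_const_mul (μ univ) (f := fun x => ∫⁻ ρ, ‖c (ρ, σ x)‖ₑ ^ (2 : ℝ) ∂μ)
          (hN.comp hσ), lintegral_prod_symm' _ (hcm.enorm.pow_const 2),
          ← smul_eq_mul k, ← lintegral_smul_measure, ← hmap, lintegral_map hN hσ]
    _ < ⊤ := ENNReal.mul_lt_top (measure_lt_top _ _) (ENNReal.mul_lt_top hk.lt_top hc2)

theorem memLp_partial_integral (hσ : Measurable σ) (hk : k ≠ ⊤)
    (hmap : π.map σ = k • ν) {A : Set (X × ℝ)} (hA : MeasurableSet A) {c : ℝ × ℝ → ℝ}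
    (hc : MemLp c 2 (μ.prod ν)) :
    MemLp (fun x => ∫ ρ, A.indicator (fun p => c (p.2, σ p.1)) (x, ρ) ∂μ) 2 π := by
  obtain ⟨c', hcm, hcc⟩ := hc.1
  refine (memLp_congr_ae ?_).2 (memLp_partial_integral_of_stronglyMeasurable hσ hk hmap hA hcm
    ((memLp_congr_ae hcc).1 hc))
  -- Replacing `c` by a strongly measurable version is allowed: Fubini gives equality on almost
  -- every line, and `σ` pulls null sets back to null sets because `π.map σ` is a multiple of `ν`.
  have h1 : ∀ᵐ s ∂ν, ∀ᵐ ρ ∂μ, c (ρ, s) = c' (ρ, s) := by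
    refine Measure.ae_ae_of_ae_prod (μ := ν) (ν := μ) (p := fun q => c (q.2, q.1) = c' (q.2, q.1)) ?_
    exact Measure.measurePreserving_swap.quasiMeasurePreserving.ae hcc
  have h2 : ∀ᵐ x ∂π, ∀ᵐ ρ ∂μ, c (ρ, σ x) = c' (ρ, σ x) := by
    refine ae_of_ae_map hσ.aemeasurable (p := fun s => ∀ᵐ ρ ∂μ, c (ρ, s) = c' (ρ, s)) ?_
    rw [hmap]
    exact Measure.ae_smul_measure h1 k
  filter_upwards [h2] with x hx
  refine integral_congr_ae ?_
  filter_upwards [hx] with ρ hρ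
  by_cases h : (x, ρ) ∈ A <;> simp [h, hρ]

end partialIntegral

variable {a b a₀ : ℝ} {f : ℝ × ℝ → ℝ} {α β : ℝ → ℝ} {c : ℝ × ℝ → ℝ}

theorem restrict_Icc_prod (a b : ℝ) : volume.restrict (Icc (0 : ℝ) a ×ˢ Icc (0 : ℝ) b) =
    (volume.restrict (Icc 0 a)).prod (volume.restrict (Icc 0 b)) := by
  rw [Measure.volume_eq_prod, Measure.prod_restrict]

theorem memLp_integral_fst (hc : MemLp c 2 (volume.restrict (Icc 0 a ×ˢ Icc 0 b))) :
    MemLp (fun s => ∫ ρ in Icc 0 a, c (ρ, s)) 2 (volume.restrict (Icc 0 b)) := by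
  rw [restrict_Icc_prod] at hc
  have := memLp_partial_integral (π := volume.restrict (Icc 0 b)) (σ := id) (k := 1)
    measurable_id (by simp) (by simp) (A := univ) MeasurableSet.univ hc
  simpa using this

theorem memLp_integral_Icc_fst (hc : MemLp c 2 (volume.restrict (Icc 0 a ×ˢ Icc 0 b))) :
    MemLp (fun q : ℝ × ℝ => ∫ ρ in Icc 0 q.1, c (ρ, q.2)) 2
      (volume.restrict (Icc 0 a ×ˢ Icc 0 b)) := by
  have hA : MeasurableSet {p : (ℝ × ℝ) × ℝ | p.2 ∈ Icc 0 p.1.1} :=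
    (measurableSet_le measurable_const measurable_snd).inter
      (measurableSet_le measurable_snd (measurable_fst.comp measurable_fst))
  have h := memLp_partial_integral (π := volume.restrict (Icc 0 a ×ˢ Icc 0 b)) (σ := Prod.snd)
    (k := volume.restrict (Icc 0 a) univ) (ν := volume.restrict (Icc 0 b)) (c := c)
    (μ := volume.restrict (Icc 0 a))
    measurable_snd (measure_ne_top _ _) (by rw [restrict_Icc_prod, Measure.map_snd_prod]) hA
    (by rwa [← restrict_Icc_prod])
  refine (memLp_congr_ae ?_).1 h
  filter_upwards [ae_restrict_mem (measurableSet_Icc.prod measurableSet_Icc)] with q hq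
  have : (fun ρ => {p : (ℝ × ℝ) × ℝ | p.2 ∈ Icc 0 p.1.1}.indicator
      (fun p => c (p.2, p.1.2)) (q, ρ)) = (Icc 0 q.1).indicator fun ρ => c (ρ, q.2) := by
    ext ρ
    simp [indicator]
  rw [this, integral_indicator measurableSet_Icc, Measure.restrict_restrict measurableSet_Icc,
    inter_eq_left.2 (Icc_subset_Icc_right hq.1.2)]

theorem ContinuousOn.memLp_Icc {g : ℝ → ℝ} (hg : ContinuousOn g (Icc 0 a)) :
    MemLp g 2 (volume.restrict (Icc 0 a)) := by
  obtain ⟨C, hC⟩ := isCompact_Icc.exists_bound_of_continuousOn hg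
  exact MemLp.of_bound (hg.aestronglyMeasurable measurableSet_Icc) C
    ((ae_restrict_mem measurableSet_Icc).mono hC)

/-! ### Primitives in one variable and traces -/

noncomputable section

/-- The primitive in the first variable. -/
def primX (f : ℝ × ℝ → ℝ) (q : ℝ × ℝ) : ℝ := ∫ r in (0 : ℝ)..q.1, f (r, q.2)

/-- The primitive in the second variable. -/
def primT (f : ℝ × ℝ → ℝ) (q : ℝ × ℝ) : ℝ := ∫ s in (0 : ℝ)..q.2, f (q.1, s)

/-- The restriction of `f` to the line `x = y`, as a function on the plane. -/
def traceX (y : ℝ) (f : ℝ × ℝ → ℝ) (q : ℝ × ℝ) : ℝ := f (y, q.2)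

end

theorem integrableOn_corner (hc : IntegrableOn c (Icc 0 a ×ˢ Icc 0 b)) {x t : ℝ}
    (hx : x ∈ Icc 0 a) (ht : t ∈ Icc 0 b) : IntegrableOn c (Icc 0 x ×ˢ Icc 0 t) :=
  hc.mono_set (prod_mono (Icc_subset_Icc_right hx.2) (Icc_subset_Icc_right ht.2))

theorem setIntegral_corner_symm (hc : IntegrableOn c (Icc 0 a ×ˢ Icc 0 b)) {x t : ℝ}
    (hx : x ∈ Icc 0 a) (ht : t ∈ Icc 0 b) :
    ∫ q in Icc 0 x ×ˢ Icc 0 t, c q = ∫ s in Icc 0 t, ∫ r in Icc 0 x, c (r, s) := by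
  have h : IntegrableOn c (Icc 0 x ×ˢ Icc 0 t) := integrableOn_corner hc hx ht
  rw [IntegrableOn, restrict_Icc_prod] at h
  rw [restrict_Icc_prod, integral_prod_symm _ h]

namespace Rep

theorem continuousOn_edge_x (h : Rep a b f a₀ α β c) (ha : 0 ≤ a) (hb : 0 ≤ b) :
    ContinuousOn (fun x => f (x, 0)) (Icc 0 a) := by
  have := (absolutelyContinuous_of_eq_integral ha h.integrableOn_left
    fun _ hx => h.eq_edge_x hb hx).continuousOn
  rwa [uIcc_of_le ha] at this

theorem traceX_right (h : Rep a b f a₀ α β c) (ha : 0 ≤ a) (hb : 0 ≤ b) :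
    Rep a b (traceX a f) (f (a, 0)) 0 (fun s => β s + ∫ r in Icc 0 a, c (r, s)) 0 := by
  have hc := memLp_integral_fst h.mixed
  refine ⟨MemLp.zero, h.right.add hc, MemLp.zero, fun x hx t ht => ?_⟩
  have hm := right_mem_Icc.2 ha
  rw [intervalIntegral.integral_add (intervalIntegrable_of_Icc ht h.integrableOn_right)
    (intervalIntegrable_of_Icc ht (hc.integrable (by norm_num))), traceX, h.eq a hm t ht,
    h.eq_edge_x hb hm, setIntegral_corner_symm h.integrableOn_mixed hm ht,
    integral_Icc_eq_integral_Ioc (x := (0 : ℝ)) (y := t), ← intervalIntegral.integral_of_le ht.1]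
  simp
  ring

/-- The primitive vanishes on `x = 0`, and its mixed derivative is `∂ₜf`, namely `β` plus the
`x`-integral of `c`. The identity is `f(r,t) = f(r,0) + ∫₀ᵗ ∂ₜf(r,s) ds` integrated in `r`. -/
theorem primX (h : Rep a b f a₀ α β c) (ha : 0 ≤ a) (hb : 0 ≤ b) :
    Rep a b (primX f) 0 (fun r => f (r, 0)) 0
      (fun q => β q.2 + ∫ ρ in Icc 0 q.1, c (ρ, q.2)) := by
  have hβ : MemLp (fun q : ℝ × ℝ => β q.2) 2 (volume.restrict (Icc 0 a ×ˢ Icc 0 b)) := by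
    rw [restrict_Icc_prod]
    exact h.right.comp_snd _
  have hc := memLp_integral_Icc_fst h.mixed
  have hcont := h.continuousOn_edge_x ha hb
  refine ⟨ContinuousOn.memLp_Icc hcont, MemLp.zero, hβ.add hc, fun x hx t ht => ?_⟩
  have hi : IntegrableOn (fun q : ℝ × ℝ => β q.2 + ∫ ρ in Icc 0 q.1, c (ρ, q.2))
      (Icc 0 x ×ˢ Icc 0 t) :=
    integrableOn_corner ((hβ.add hc).integrable (by norm_num)) hx ht
  rw [IntegrableOn, restrict_Icc_prod] at hi
  have hae : (fun r => ∫ s in Icc 0 t, (β s + ∫ ρ in Icc 0 r, c (ρ, s)))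
      =ᵐ[volume.restrict (Icc 0 x)]
      fun r => (∫ s in (0 : ℝ)..t, β s) + ∫ q in Icc 0 r ×ˢ Icc 0 t, c q := by
    have h3 := integrableOn_corner (hc.integrable (by norm_num : (1 : ENNReal) ≤ 2)) hx ht
    rw [IntegrableOn, restrict_Icc_prod] at h3
    filter_upwards [h3.prod_right_ae, ae_restrict_mem measurableSet_Icc] with r hr hrx
    have hra : r ∈ Icc 0 a := ⟨hrx.1, hrx.2.trans hx.2⟩
    rw [setIntegral_corner_symm h.integrableOn_mixed hra ht, intervalIntegral.integral_of_le ht.1,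
      ← integral_Icc_eq_integral_Ioc, ← integral_add (h.integrableOn_right.mono_set
      (Icc_subset_Icc_right ht.2)) hr]
  have hi2 : IntervalIntegrable (fun r => (∫ s in (0 : ℝ)..t, β s) +
      ∫ q in Icc 0 r ×ˢ Icc 0 t, c q) volume 0 x :=
    intervalIntegrable_of_Icc (right_mem_Icc.2 hx.1) (hi.integral_prod_left.congr hae)
  rw [restrict_Icc_prod, integral_prod _ hi, integral_congr_ae hae, integral_Icc_eq_integral_Ioc,
    ← intervalIntegral.integral_of_le hx.1]
  simp only [intervalIntegral.integral_zero, Pi.zero_apply, zero_add, add_zero]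
  rw [← intervalIntegral.integral_add
    ((hcont.mono (Icc_subset_Icc_right hx.2)).intervalIntegrable_of_Icc hx.1) hi2]
  refine intervalIntegral.integral_congr fun r hr => ?_
  rw [uIcc_of_le hx.1] at hr
  have hra : r ∈ Icc 0 a := ⟨hr.1, hr.2.trans hx.2⟩
  simp only
  rw [h.eq r hra t ht, h.eq_edge_x hb hra]
  ring

theorem primT (h : Rep a b f a₀ α β c) (ha : 0 ≤ a) (hb : 0 ≤ b) :
    Rep a b (primT f) 0 0 (fun s => f (0, s))
      (fun q => α q.1 + ∫ ρ in Icc 0 q.2, c (q.1, ρ)) :=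
  (h.swap.primX hb ha).swap

end Rep

/-! ### `Ŵ(Ω)` as a Hilbert space -/

noncomputable section

/-- The Hilbert space of the data `(f(0,0), ∂ₓf(·,0), ∂ₜf(0,·), ∂ₓ∂ₜf)` of the functions `f` of
`Ŵ(Ω)`. -/
abbrev Data (T : ℝ) : Type :=
  WithLp 2 (WithLp 2 (ℝ × Lp ℝ 2 (volume.restrict (Icc (0 : ℝ) 1))) ×
    WithLp 2 (Lp ℝ 2 (volume.restrict (Icc (0 : ℝ) T)) × Lp ℝ 2 (volume.restrict (rect T))))

namespace Data

variable {T : ℝ}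

/-- The value at the origin. -/
def value : Data T →L[ℝ] ℝ := (WithLp.fstL 2 ℝ _ _).comp (WithLp.fstL 2 ℝ _ _)

/-- The derivative along the edge `t = 0`. -/
def left : Data T →L[ℝ] Lp ℝ 2 (volume.restrict (Icc (0 : ℝ) 1)) :=
  (WithLp.sndL 2 ℝ _ _).comp (WithLp.fstL 2 ℝ _ _)

/-- The derivative along the edge `x = 0`. -/
def right : Data T →L[ℝ] Lp ℝ 2 (volume.restrict (Icc (0 : ℝ) T)) :=
  (WithLp.fstL 2 ℝ _ _).comp (WithLp.sndL 2 ℝ _ _)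

/-- The mixed derivative. -/
def mixed : Data T →L[ℝ] Lp ℝ 2 (volume.restrict (rect T)) :=
  (WithLp.sndL 2 ℝ _ _).comp (WithLp.sndL 2 ℝ _ _)

/-- The data with the given components. -/
def mk (a₀ : ℝ) (α : Lp ℝ 2 (volume.restrict (Icc (0 : ℝ) 1)))
    (β : Lp ℝ 2 (volume.restrict (Icc (0 : ℝ) T))) (c : Lp ℝ 2 (volume.restrict (rect T))) :
    Data T :=
  WithLp.toLp 2 (WithLp.toLp 2 (a₀, α), WithLp.toLp 2 (β, c))

theorem inner_eq (h k : Data T) : inner ℝ h k = value h * value k + inner ℝ (left h) (left k) +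
    inner ℝ (right h) (right k) + inner ℝ (mixed h) (mixed k) := by
  have e : inner ℝ (value h) (value k) = value h * value k := by
    simp [mul_comm]
  rw [← e, add_assoc]
  rfl

/-- The data that represent the evaluation at a point. -/
def eval (T : ℝ) (z : ℝ × ℝ) : Data T :=
  mk 1 (indicatorConstLp 2 (measurableSet_Icc (a := 0) (b := z.1)) (measure_ne_top _ _) 1)
    (indicatorConstLp 2 (measurableSet_Icc (a := 0) (b := z.2)) (measure_ne_top _ _) 1)
    (indicatorConstLp 2 ((measurableSet_Icc (a := 0) (b := z.1)).prod
      (measurableSet_Icc (a := 0) (b := z.2))) (measure_ne_top _ _) 1)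

/-- The function with given data. -/
def toFun (h : Data T) (z : ℝ × ℝ) : ℝ := inner ℝ (eval T z) h

theorem toFun_add (h k : Data T) : toFun (h + k) = toFun h + toFun k := by
  ext z; simp [toFun, inner_add_right]

theorem toFun_sub (h k : Data T) : toFun (h - k) = toFun h - toFun k := by
  ext z; simp [toFun, inner_sub_right]

theorem toFun_smul (r : ℝ) (h : Data T) : toFun (r • h) = r • toFun h := by
  ext z; simp [toFun, inner_smul_right]

theorem setIntegral_restrict_of_subset {X : Type*} [MeasurableSpace X] {μ : Measure X} {s t : Set X}
    (hs : MeasurableSet s) (hst : s ⊆ t) (f : X → ℝ) :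
    ∫ x in s, f x ∂(μ.restrict t) = ∫ x in s, f x ∂μ := by
  rw [Measure.restrict_restrict hs, inter_eq_left.2 hst]

theorem inner_left_eval (h : Data T) {x : ℝ} (hx : x ∈ Icc (0 : ℝ) 1) (t : ℝ) :
    inner ℝ (left (eval T (x, t))) (left h) = ∫ r in (0 : ℝ)..x, left h r := by
  rw [intervalIntegral.integral_of_le hx.1, ← integral_Icc_eq_integral_Ioc,
    ← setIntegral_restrict_of_subset measurableSet_Icc (Icc_subset_Icc_right hx.2)]
  exact L2.inner_indicatorConstLp_one measurableSet_Icc (measure_ne_top _ _) _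

theorem toFun_rep (h : Data T) : Rep 1 T (toFun h) (value h) (left h) (right h) (mixed h) := by
  refine ⟨Lp.memLp _, Lp.memLp _, Lp.memLp _, fun x hx t ht => ?_⟩
  have e2 : inner ℝ (right (eval T (x, t))) (right h) = ∫ r in (0 : ℝ)..t, right h r := by
    rw [intervalIntegral.integral_of_le ht.1, ← integral_Icc_eq_integral_Ioc,
      ← setIntegral_restrict_of_subset measurableSet_Icc (Icc_subset_Icc_right ht.2)]
    exact L2.inner_indicatorConstLp_one measurableSet_Icc (measure_ne_top _ _) _
  have e3 : inner ℝ (mixed (eval T (x, t))) (mixed h) = ∫ q in Icc 0 x ×ˢ Icc 0 t, mixed h q := by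
    rw [← setIntegral_restrict_of_subset (measurableSet_Icc.prod measurableSet_Icc)
      (prod_mono (Icc_subset_Icc_right hx.2) (Icc_subset_Icc_right ht.2))]
    exact L2.inner_indicatorConstLp_one (measurableSet_Icc.prod measurableSet_Icc)
      (measure_ne_top _ _) _
  rw [toFun, inner_eq, inner_left_eval h hx, e2, e3]
  simp [eval, value, mk]

theorem toFun_memWhat (hT : 0 ≤ T) (h : Data T) : MemWhat T (toFun h) := h.toFun_rep.memWhat hT

theorem innerWhat_toFun (hT : 0 ≤ T) (h k : Data T) :
    innerWhat T (toFun h) (toFun k) = inner ℝ h k := by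
  rw [h.toFun_rep.innerWhat_eq hT k.toFun_rep, inner_eq, L2.inner_def, L2.inner_def, L2.inner_def]
  have e : ∀ x y : ℝ, inner ℝ x y = x * y := fun x y => by simp [mul_comm]
  simp only [e]

/-- The zero function is also represented by zero data, and `innerWhat` does not depend on the
representation, so `‖h‖² = 0`. -/
theorem eq_zero_of_toFun (hT : 0 ≤ T) {h : Data T} (hz : ∀ z ∈ rect T, toFun h z = 0) : h = 0 := by
  have hr : Rep 1 T (toFun h) 0 0 0 0 := by
    refine ⟨MemLp.zero, MemLp.zero, MemLp.zero, fun x hx t ht => ?_⟩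
    simp [hz (x, t) ⟨hx, ht⟩]
  have := innerWhat_toFun hT h h
  rw [hr.innerWhat_eq hT hr] at this
  simpa using this.symm

theorem toFun_injOn (hT : 0 ≤ T) {h k : Data T} (hz : EqOn (toFun h) (toFun k) (rect T)) :
    h = k := by
  refine sub_eq_zero.1 (eq_zero_of_toFun hT fun z hr => ?_)
  simp [toFun_sub, hz hr]

theorem exists_of_rep {f : ℝ × ℝ → ℝ} {a₀ : ℝ} {α β : ℝ → ℝ} {c : ℝ × ℝ → ℝ}
    (hf : Rep 1 T f a₀ α β c) : ∃ h : Data T, EqOn f (toFun h) (rect T) := by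
  refine ⟨mk a₀ (hf.left.toLp α) (hf.right.toLp β) (MemLp.toLp c hf.mixed), ?_⟩
  rintro ⟨x, t⟩ ⟨hx, ht⟩
  rw [hf.eq x hx t ht, (toFun_rep _).eq x hx t ht]
  congr 1
  · congr 1
    · congr 1
      exact integral_congr_Icc hx hf.left.coeFn_toLp.symm
    · exact integral_congr_Icc ht hf.right.coeFn_toLp.symm
  · exact integral_congr_ae (ae_restrict_of_ae_restrict_of_subset
      (prod_mono (Icc_subset_Icc_right hx.2) (Icc_subset_Icc_right ht.2))
      (MemLp.coeFn_toLp hf.mixed).symm)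

theorem exists_of_memWhat {f : ℝ × ℝ → ℝ} (hf : MemWhat T f) :
    ∃ h : Data T, EqOn f (toFun h) (rect T) :=
  exists_of_rep hf.rep

theorem kernel1_eq (y x : ℝ) : kernel1 y x = 1 + min x y := by
  rw [kernel1, min_def]
  split_ifs <;> rfl

theorem volume_real_Icc_inter_Icc {x y a : ℝ} (hx : x ∈ Icc 0 a) (hy : y ∈ Icc 0 a) :
    (volume.restrict (Icc (0 : ℝ) a)).real (Icc 0 x ∩ Icc 0 y) = min x y := by
  have : (Icc 0 x ∩ Icc 0 y) ∩ Icc (0 : ℝ) a = Icc 0 (min x y) := by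
    ext r
    simp only [mem_inter_iff, mem_Icc, le_min_iff]
    have := hx.2
    constructor
    · tauto
    · rintro ⟨h0, h1, h2⟩
      exact ⟨⟨⟨h0, h1⟩, h0, h2⟩, h0, h1.trans this⟩
  rw [measureReal_restrict_apply (measurableSet_Icc.inter measurableSet_Icc), this,
    Real.volume_real_Icc_of_le (le_min hx.1 hy.1), sub_zero]

theorem inner_left_eval_eval {z q : ℝ × ℝ} (hz : z ∈ rect T) (hq : q ∈ rect T) :
    inner ℝ (left (eval T q)) (left (eval T z)) = min q.1 z.1 := by
  rw [← volume_real_Icc_inter_Icc hq.1 hz.1]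
  refine (L2.inner_indicatorConstLp_indicatorConstLp measurableSet_Icc measurableSet_Icc
    (measure_ne_top _ _) (measure_ne_top _ _) _ _).trans ?_
  simp

/-- The four components contribute `1`, `min`, `min` and the product of the two minima, which is the
expansion of `(1 + min)(1 + min)`. -/
theorem inner_eval {z q : ℝ × ℝ} (hz : z ∈ rect T) (hq : q ∈ rect T) :
    inner ℝ (eval T q) (eval T z) = G z q := by
  have e2 : inner ℝ (right (eval T q)) (right (eval T z)) = min q.2 z.2 := by
    rw [← volume_real_Icc_inter_Icc hq.2 hz.2]
    refine (L2.inner_indicatorConstLp_indicatorConstLp measurableSet_Icc measurableSet_Icc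
      (measure_ne_top _ _) (measure_ne_top _ _) _ _).trans ?_
    simp
  have e3 : inner ℝ (mixed (eval T q)) (mixed (eval T z)) = min q.1 z.1 * min q.2 z.2 := by
    rw [← volume_real_Icc_inter_Icc hq.2 hz.2, ← volume_real_Icc_inter_Icc hq.1 hz.1,
      ← measureReal_prod_prod, ← restrict_Icc_prod, ← prod_inter_prod]
    refine (L2.inner_indicatorConstLp_indicatorConstLp (measurableSet_Icc.prod measurableSet_Icc)
      (measurableSet_Icc.prod measurableSet_Icc) (measure_ne_top _ _) (measure_ne_top _ _) _ _).trans ?_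
    simp [rect]
  rw [inner_eq, inner_left_eval_eval hz hq, e2, e3, G, kernel1_eq, kernel1_eq]
  simp [value, eval, mk]
  ring

theorem continuous_G : Continuous fun p : (ℝ × ℝ) × ℝ × ℝ => G p.1 p.2 := by
  simp only [G, kernel1_eq]
  fun_prop

/-- `‖eval q - eval z‖² = G q q - 2 G z q + G z z`, and `G` is continuous. Hence all functions of
`Ŵ(Ω)` are continuous on `Ω`. -/
theorem continuousOn_eval : ContinuousOn (eval T) (rect T) := by
  intro z hz
  rw [ContinuousWithinAt, tendsto_iff_norm_sub_tendsto_zero]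
  have h : Filter.Tendsto (fun q => √(G q q - 2 * G z q + G z z)) (nhdsWithin z (rect T))
      (nhds (√(G z z - 2 * G z z + G z z))) := by
    have hc : Continuous fun q => √(G q q - 2 * G z q + G z z) := by
      have h1 : Continuous fun q => G q q := continuous_G.comp (by fun_prop : Continuous
        fun q : ℝ × ℝ => (q, q))
      have h2 : Continuous fun q => G z q := continuous_G.comp (by fun_prop : Continuous
        fun q : ℝ × ℝ => (z, q))
      fun_prop
    exact hc.continuousWithinAt
  have e : √(G z z - 2 * G z z + G z z) = 0 := by ring_nf; simp
  rw [e] at h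
  refine h.congr' ?_
  filter_upwards [self_mem_nhdsWithin] with q hq
  rw [← inner_eval hq hq, ← inner_eval hz hq, ← inner_eval hz hz, real_inner_self_eq_norm_sq,
    real_inner_self_eq_norm_sq, ← norm_sub_sq_real, Real.sqrt_sq (norm_nonneg _)]

theorem continuousOn_toFun (h : Data T) : ContinuousOn (toFun h) (rect T) := by
  unfold toFun
  exact continuousOn_eval.inner continuousOn_const

end Data

variable {T : ℝ}

theorem MemWhat.continuousOn {f : ℝ × ℝ → ℝ} (hf : MemWhat T f) : ContinuousOn f (rect T) := by
  obtain ⟨h, hh⟩ := Data.exists_of_memWhat hf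
  exact h.continuousOn_toFun.congr hh

theorem G_rep {z : ℝ × ℝ} (hz : z ∈ rect T) :
    EqOn (G z) (Data.toFun (Data.eval T z)) (rect T) := fun _ hq => (Data.inner_eval hz hq).symm

theorem innerWhat_congr (hT : 0 ≤ T) {f f' g g' : ℝ × ℝ → ℝ} (hf : MemWhat T f) (hg : MemWhat T g)
    (hff : EqOn f f' (rect T)) (hgg : EqOn g g' (rect T)) :
    innerWhat T f' g' = innerWhat T f g := by
  rw [(hf.rep.congr hff).innerWhat_eq hT (hg.rep.congr hgg), hf.rep.innerWhat_eq hT hg.rep]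

theorem isReproducingKernel_G (hT : 0 ≤ T) :
    IsReproducingKernel (rect T) (What T) (innerWhat T) G := by
  have hG : ∀ z ∈ rect T, MemWhat T (G z) := fun z hz =>
    ((Data.eval T z).toFun_memWhat hT).congr hT (G_rep hz).symm
  refine ⟨hG, fun z hz f hf => ?_⟩
  obtain ⟨h, hh⟩ := Data.exists_of_memWhat hf
  rw [← innerWhat_congr hT hf (hG z hz) hh (G_rep hz), Data.innerWhat_toFun hT, hh hz,
    real_inner_comm]
  rfl

/-- A linear operator on `Ŵ(Ω)` with continuous point evaluations is bounded. -/
theorem exists_clm (hT : 0 ≤ T) (Φ : (ℝ × ℝ → ℝ) → ℝ × ℝ → ℝ)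
    (hΦ : ∀ h : Data T, MemWhat T (Φ h.toFun))
    (hc : ∀ z ∈ rect T, ∃ l : Data T →L[ℝ] ℝ, ∀ h : Data T, Φ h.toFun z = l h) :
    ∃ M : Data T →L[ℝ] Data T, ∀ h, EqOn (Φ h.toFun) (M h).toFun (rect T) := by
  choose m hm using fun h => Data.exists_of_memWhat (hΦ h)
  choose! l hl using hc
  -- Linearity of `Φ` is not assumed: it follows from that of the functionals `l z`, because data
  -- are determined by the values on `Ω`.
  let g : Data T →ₗ[ℝ] Data T :=
    { toFun := m
      map_add' := fun h k => Data.toFun_injOn hT fun z hz => by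
        rw [Data.toFun_add, Pi.add_apply, ← hm _ hz, ← hm _ hz, ← hm _ hz, hl z hz, hl z hz,
          hl z hz, map_add]
      map_smul' := fun r h => Data.toFun_injOn hT fun z hz => by
        rw [RingHom.id_apply, Data.toFun_smul, Pi.smul_apply, ← hm _ hz, ← hm _ hz, hl z hz,
          hl z hz, map_smul] }
  have hg : Continuous g := by
    -- Closed graph theorem: the values at `z` converge to `y z` through continuity of evaluation,
    -- and to `l z x` through continuity of `l z`.
    refine g.continuous_of_seq_closed_graph fun u x y hu hv => Data.toFun_injOn hT fun z hz => ?_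
    have h1 : Filter.Tendsto (fun n => Data.toFun (m (u n)) z) Filter.atTop
        (nhds (Data.toFun y z)) := tendsto_const_nhds.inner hv
    have h2 : Filter.Tendsto (fun n => l z (u n)) Filter.atTop (nhds (l z x)) :=
      ((l z).continuous.tendsto x).comp hu
    refine tendsto_nhds_unique h1 ?_
    have e : Data.toFun (g x) z = l z x := by rw [← hl z hz]; exact (hm x hz).symm
    rw [e]
    refine h2.congr fun n => ?_
    rw [← hl z hz, hm _ hz]
  exact ⟨⟨g, hg⟩, fun h => hm h⟩

end

/-! ### Two fold primitives of one variable -/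

theorem hasDerivWithinAt_integral {g : ℝ → ℝ} {a x : ℝ} (hg : ContinuousOn g (Icc 0 a))
    (hx : x ∈ Icc 0 a) :
    HasDerivWithinAt (fun x => ∫ r in (0 : ℝ)..x, g r) (g x) (Icc 0 a) x := by
  have : Fact (x ∈ Icc 0 a) := ⟨hx⟩
  exact intervalIntegral.integral_hasDerivWithinAt_right
    ((hg.mono (Icc_subset_Icc_right hx.2)).intervalIntegrable_of_Icc hx.1)
    (hg.stronglyMeasurableAtFilter_nhdsWithin measurableSet_Icc x) (hg x hx)

section secondDerivative

variable {a : ℝ} {f₀ f₁ f₂ : ℝ → ℝ}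

theorem iteratedDerivWithin_one_eqOn (ha : 0 < a)
    (h₀ : ∀ x ∈ Icc 0 a, HasDerivWithinAt f₀ (f₁ x) (Icc 0 a) x) :
    EqOn (iteratedDerivWithin 1 f₀ (Icc 0 a)) f₁ (Icc 0 a) := fun x hx => by
  rw [iteratedDerivWithin_one]
  exact (h₀ x hx).derivWithin (uniqueDiffOn_Icc ha x hx)

theorem iteratedDerivWithin_two_eqOn (ha : 0 < a)
    (h₀ : ∀ x ∈ Icc 0 a, HasDerivWithinAt f₀ (f₁ x) (Icc 0 a) x)
    (h₁ : ∀ x ∈ Icc 0 a, HasDerivWithinAt f₁ (f₂ x) (Icc 0 a) x) :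
    EqOn (iteratedDerivWithin 2 f₀ (Icc 0 a)) f₂ (Icc 0 a) := fun x hx => by
  have e := iteratedDerivWithin_one_eqOn ha h₀
  rw [iteratedDerivWithin_succ, derivWithin_congr e (e hx)]
  exact (h₁ x hx).derivWithin (uniqueDiffOn_Icc ha x hx)

theorem contDiffOn_two_of_hasDerivWithinAt (ha : 0 < a)
    (h₀ : ∀ x ∈ Icc 0 a, HasDerivWithinAt f₀ (f₁ x) (Icc 0 a) x)
    (h₁ : ∀ x ∈ Icc 0 a, HasDerivWithinAt f₁ (f₂ x) (Icc 0 a) x)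
    (h₂ : ContinuousOn f₂ (Icc 0 a)) : ContDiffOn ℝ 2 f₀ (Icc 0 a) := by
  have e1 := iteratedDerivWithin_one_eqOn ha h₀
  have e2 := iteratedDerivWithin_two_eqOn ha h₀ h₁
  have d0 : DifferentiableOn ℝ f₀ (Icc 0 a) := fun x hx => (h₀ x hx).differentiableWithinAt
  have d1 : DifferentiableOn ℝ f₁ (Icc 0 a) := fun x hx => (h₁ x hx).differentiableWithinAt
  refine contDiffOn_of_continuousOn_differentiableOn_deriv (n := 2) (fun m hm => ?_) fun m hm => ?_
  · have hm : m ≤ 2 := by exact_mod_cast hm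
    interval_cases m
    · simpa using d0.continuousOn
    · exact d1.continuousOn.congr e1
    · exact h₂.congr e2
  · have hm : m < 2 := by exact_mod_cast hm
    interval_cases m
    · simpa using d0
    · exact d1.congr e1

theorem hasDerivWithinAt_of_contDiffOn_two (h : ContDiffOn ℝ 2 f₀ (Icc 0 a)) {x : ℝ}
    (hx : x ∈ Icc 0 a) :
    HasDerivWithinAt f₀ (iteratedDerivWithin 1 f₀ (Icc 0 a) x) (Icc 0 a) x := by
  rw [iteratedDerivWithin_one]
  exact (h.differentiableOn (by norm_num) x hx).hasDerivWithinAt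

theorem hasDerivWithinAt_one_of_contDiffOn_two (ha : 0 < a) (h : ContDiffOn ℝ 2 f₀ (Icc 0 a)) {x : ℝ}
    (hx : x ∈ Icc 0 a) :
    HasDerivWithinAt (iteratedDerivWithin 1 f₀ (Icc 0 a))
      (iteratedDerivWithin 2 f₀ (Icc 0 a) x) (Icc 0 a) x := by
  rw [iteratedDerivWithin_succ (n := 1)]
  exact (h.differentiableOn_iteratedDerivWithin (m := 1) (by norm_num)
    (uniqueDiffOn_Icc ha) x hx).hasDerivWithinAt

theorem eq_add_integral_of_hasDerivWithinAt
    (h₀ : ∀ x ∈ Icc 0 a, HasDerivWithinAt f₀ (f₁ x) (Icc 0 a) x)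
    (h₁ : ContinuousOn f₁ (Icc 0 a)) {x : ℝ} (hx : x ∈ Icc 0 a) :
    f₀ x = f₀ 0 + ∫ r in (0 : ℝ)..x, f₁ r := by
  have hs : Icc 0 x ⊆ Icc 0 a := Icc_subset_Icc_right hx.2
  rw [intervalIntegral.integral_eq_sub_of_hasDerivAt_of_le hx.1 (f := f₀)
    (fun y hy => (h₀ y (hs hy)).continuousWithinAt.mono hs)
    (fun y hy => (h₀ y (hs (Ioo_subset_Icc_self hy))).hasDerivAt
      (Icc_mem_nhds hy.1 (hy.2.trans_le hx.2)))
    ((h₁.mono hs).intervalIntegrable_of_Icc hx.1)]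
  ring

end secondDerivative

/-! ### The Green operators -/

noncomputable section

/-- The derivative of the solution `v` of `∂ₓ²v = f`, `v(0,·) = v(1,·) = 0`. -/
def greenX' (f : ℝ × ℝ → ℝ) : ℝ × ℝ → ℝ := primX f - traceX 1 (primX (primX f))

/-- The solution `v` of `∂ₓ²v = f`, `v(0,·) = v(1,·) = 0`. -/
def greenX (f : ℝ × ℝ → ℝ) : ℝ × ℝ → ℝ := primX (greenX' f)

/-- The `i`-th derivative of `greenX f` in `x`. -/
def opX : ℕ → (ℝ × ℝ → ℝ) → ℝ × ℝ → ℝ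
  | 0 => greenX
  | 1 => greenX'
  | _ => id

/-- The `j`-th derivative in `t` of the function with second derivative `f` and vanishing initial
data. -/
def opT : ℕ → (ℝ × ℝ → ℝ) → ℝ × ℝ → ℝ
  | 0 => fun f => primT (primT f)
  | 1 => primT
  | _ => id

/-- The function `u` with `∂ₓ²∂ₜ²u = w`, `u(·,0) = ∂ₜu(·,0) = 0` and `u(0,·) = u(1,·) = 0`. -/
def solve (w : ℝ × ℝ → ℝ) : ℝ × ℝ → ℝ := greenX (primT (primT w))

end

variable {T : ℝ} {f g u w : ℝ × ℝ → ℝ}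

theorem primX_congr (h : EqOn f g (rect T)) : EqOn (primX f) (primX g) (rect T) := by
  rintro ⟨x, t⟩ ⟨hx, ht⟩
  refine intervalIntegral.integral_congr fun r hr => h ?_
  rw [uIcc_of_le hx.1] at hr
  exact ⟨⟨hr.1, hr.2.trans hx.2⟩, ht⟩

theorem primT_congr (h : EqOn f g (rect T)) : EqOn (primT f) (primT g) (rect T) := by
  rintro ⟨x, t⟩ ⟨hx, ht⟩
  refine intervalIntegral.integral_congr fun r hr => h ?_
  rw [uIcc_of_le ht.1] at hr
  exact ⟨hx, ⟨hr.1, hr.2.trans ht.2⟩⟩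

theorem greenX'_congr (h : EqOn f g (rect T)) : EqOn (greenX' f) (greenX' g) (rect T) := by
  rintro ⟨x, t⟩ ⟨hx, ht⟩
  have h1 := primX_congr h ⟨hx, ht⟩
  have h2 := primX_congr (primX_congr h) (x := (1, t)) ⟨right_mem_Icc.2 zero_le_one, ht⟩
  simp [greenX', traceX, h1, h2]

theorem greenX_congr (h : EqOn f g (rect T)) : EqOn (greenX f) (greenX g) (rect T) :=
  primX_congr (greenX'_congr h)

theorem MemWhat.sub (hT : 0 ≤ T) (hf : MemWhat T f) (hg : MemWhat T g) : MemWhat T (f - g) := by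
  obtain ⟨h, hh⟩ := Data.exists_of_memWhat hf
  obtain ⟨k, hk⟩ := Data.exists_of_memWhat hg
  refine ((h - k).toFun_memWhat hT).congr hT fun z hz => ?_
  simp [Data.toFun_sub, hh hz, hk hz]

theorem MemWhat.primX (hT : 0 ≤ T) (hf : MemWhat T f) : MemWhat T (primX f) :=
  (hf.rep.primX zero_le_one hT).memWhat hT

theorem MemWhat.primT (hT : 0 ≤ T) (hf : MemWhat T f) : MemWhat T (primT f) :=
  (hf.rep.primT zero_le_one hT).memWhat hT

theorem MemWhat.greenX' (hT : 0 ≤ T) (hf : MemWhat T f) : MemWhat T (greenX' f) :=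
  (hf.primX hT).sub hT ((((hf.primX hT).primX hT).rep.traceX_right zero_le_one hT).memWhat hT)

theorem MemWhat.greenX (hT : 0 ≤ T) (hf : MemWhat T f) : MemWhat T (greenX f) :=
  (hf.greenX' hT).primX hT

theorem MemWhat.opX (hT : 0 ≤ T) (hf : MemWhat T f) : ∀ i, MemWhat T (opX i f)
  | 0 => hf.greenX hT
  | 1 => hf.greenX' hT
  | _ + 2 => hf

theorem MemWhat.opT (hT : 0 ≤ T) (hf : MemWhat T f) : ∀ j, MemWhat T (opT j f)
  | 0 => (hf.primT hT).primT hT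
  | 1 => hf.primT hT
  | _ + 2 => hf

theorem continuousOn_section_x (hf : ContinuousOn f (rect T)) {t : ℝ} (ht : t ∈ Icc 0 T) :
    ContinuousOn (fun x => f (x, t)) (Icc 0 1) :=
  hf.comp (by fun_prop) fun _ hx => ⟨hx, ht⟩

theorem continuousOn_section_t (hf : ContinuousOn f (rect T)) {x : ℝ} (hx : x ∈ Icc (0 : ℝ) 1) :
    ContinuousOn (fun t => f (x, t)) (Icc 0 T) :=
  hf.comp (by fun_prop) fun _ ht => ⟨hx, ht⟩

theorem hasDerivWithinAt_primX (hf : ContinuousOn f (rect T)) {x t : ℝ} (hx : x ∈ Icc (0 : ℝ) 1)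
    (ht : t ∈ Icc 0 T) :
    HasDerivWithinAt (fun x => primX f (x, t)) (f (x, t)) (Icc 0 1) x :=
  hasDerivWithinAt_integral (continuousOn_section_x hf ht) hx

theorem hasDerivWithinAt_primT (hf : ContinuousOn f (rect T)) {x t : ℝ} (hx : x ∈ Icc (0 : ℝ) 1)
    (ht : t ∈ Icc 0 T) :
    HasDerivWithinAt (fun t => primT f (x, t)) (f (x, t)) (Icc 0 T) t :=
  hasDerivWithinAt_integral (continuousOn_section_t hf hx) ht

theorem hasDerivWithinAt_greenX' (hf : ContinuousOn f (rect T)) {x t : ℝ}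
    (hx : x ∈ Icc (0 : ℝ) 1) (ht : t ∈ Icc 0 T) :
    HasDerivWithinAt (fun x => greenX' f (x, t)) (f (x, t)) (Icc 0 1) x :=
  (hasDerivWithinAt_primX hf hx ht).sub_const (primX (primX f) (1, t))

theorem primX_primT (hf : ContinuousOn f (rect T)) :
    EqOn (primX (primT f)) (primT (primX f)) (rect T) := by
  rintro ⟨x, t⟩ ⟨hx, ht⟩
  refine intervalIntegral_intervalIntegral_swap (F := fun r s => f (r, s)) ?_
  rw [uIoc_of_le hx.1, uIoc_of_le ht.1]
  refine (hf.integrableOn_compact (isCompact_Icc.prod isCompact_Icc)).mono_set ?_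
  exact prod_mono (Ioc_subset_Icc_self.trans (Icc_subset_Icc_right hx.2))
    (Ioc_subset_Icc_self.trans (Icc_subset_Icc_right ht.2))

theorem greenX'_primT (hT : 0 ≤ T) (hf : MemWhat T f) :
    EqOn (greenX' (primT f)) (primT (greenX' f)) (rect T) := by
  rintro ⟨x, t⟩ ⟨hx, ht⟩
  have h1 : (1 : ℝ) ∈ Icc (0 : ℝ) 1 := right_mem_Icc.2 zero_le_one
  have hi : ∀ {g : ℝ × ℝ → ℝ} {y : ℝ}, MemWhat T g → y ∈ Icc (0 : ℝ) 1 →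
      IntervalIntegrable (fun s => g (y, s)) volume 0 t := fun hg hy =>
    ((continuousOn_section_t hg.continuousOn hy).mono
      (Icc_subset_Icc_right ht.2)).intervalIntegrable_of_Icc ht.1
  have e : primT (greenX' f) (x, t) = primT (primX f) (x, t) - primT (primX (primX f)) (1, t) :=
    intervalIntegral.integral_sub (g := fun s => primX (primX f) (1, s)) (hi (hf.primX hT) hx)
      (hi ((hf.primX hT).primX hT) h1)
  rw [e, ← primX_primT hf.continuousOn ⟨hx, ht⟩,
    ← primX_primT (hf.primX hT).continuousOn (x := (1, t)) ⟨h1, ht⟩,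
    ← primX_congr (primX_primT hf.continuousOn) (x := (1, t)) ⟨h1, ht⟩]
  rfl

theorem greenX_primT (hT : 0 ≤ T) (hf : MemWhat T f) :
    EqOn (greenX (primT f)) (primT (greenX f)) (rect T) :=
  (primX_congr (greenX'_primT hT hf)).trans (primX_primT (hf.greenX' hT).continuousOn)

/-- `pd` differentiates in `t` first, so the `t`-primitives are needed outermost; by Fubini they
commute with the Green operator. -/
theorem solve_eqOn (hT : 0 ≤ T) (hw : MemWhat T w) :
    EqOn (solve w) (primT (primT (greenX w))) (rect T) :=
  (greenX_primT hT (hw.primT hT)).trans (primT_congr (greenX_primT hT hw))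

theorem greenX_left (f : ℝ × ℝ → ℝ) (t : ℝ) : greenX f (0, t) = 0 := by
  simp [greenX, primX]

theorem greenX_right (hT : 0 ≤ T) (hf : MemWhat T f) {t : ℝ} (ht : t ∈ Icc 0 T) :
    greenX f (1, t) = 0 := by
  have hi := (continuousOn_section_x (hf.primX hT).continuousOn ht).intervalIntegrable_of_Icc
    (μ := volume) zero_le_one
  have : greenX f (1, t) = (∫ r in (0 : ℝ)..1, primX f (r, t)) -
      ∫ _ in (0 : ℝ)..1, primX (primX f) (1, t) :=
    intervalIntegral.integral_sub (g := fun _ => primX (primX f) (1, t)) hi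
      intervalIntegrable_const
  rw [this]
  simp [primX]

theorem greenX_bottom (hf : ∀ x, f (x, 0) = 0) (x : ℝ) : greenX f (x, 0) = 0 := by
  simp [greenX, greenX', primX, traceX, hf]

theorem opT_bottom (f : ℝ × ℝ → ℝ) {j : ℕ} (hj : j < 2) (x : ℝ) : opT j f (x, 0) = 0 := by
  interval_cases j <;> simp [opT, primT]

/-! ### The partial derivatives of `solve w` -/

theorem iteratedDerivWithin_pd (T : ℝ) (i k : ℕ) (u : ℝ × ℝ → ℝ) (t : ℝ) :
    iteratedDerivWithin k (fun x => pd T 0 i u (x, t)) (Icc 0 1) = fun x => pd T k i u (x, t) := by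
  simp [pd]

theorem pd_congr {u v : ℝ × ℝ → ℝ} (h : EqOn u v (rect T)) (i j : ℕ) :
    EqOn (pd T i j u) (pd T i j v) (rect T) := by
  rintro ⟨x, t⟩ ⟨hx, ht⟩
  refine iteratedDerivWithin_congr (fun x hx => ?_) hx
  exact iteratedDerivWithin_congr (fun t ht => h ⟨hx, ht⟩) ht

theorem pd_zero_solve (hT : 0 < T) (hw : MemWhat T w) {j : ℕ} (hj : j ≤ 2) :
    EqOn (pd T 0 j (solve w)) (greenX (opT j w)) (rect T) := by
  rintro ⟨x, t⟩ ⟨hx, ht⟩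
  have hv := hw.greenX hT.le
  have e : EqOn (fun t => solve w (x, t)) (fun t => primT (primT (greenX w)) (x, t)) (Icc 0 T) :=
    fun s hs => solve_eqOn hT.le hw ⟨hx, hs⟩
  have h₀ : ∀ s ∈ Icc 0 T, HasDerivWithinAt (fun t => primT (primT (greenX w)) (x, t))
      (primT (greenX w) (x, s)) (Icc 0 T) s := fun s hs =>
    hasDerivWithinAt_primT (hv.primT hT.le).continuousOn hx hs
  have h₁ : ∀ s ∈ Icc 0 T, HasDerivWithinAt (fun t => primT (greenX w) (x, t))
      (greenX w (x, s)) (Icc 0 T) s := fun s hs =>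
    hasDerivWithinAt_primT hv.continuousOn hx hs
  simp only [pd, iteratedDerivWithin_zero]
  rw [iteratedDerivWithin_congr e ht]
  interval_cases j
  · rw [iteratedDerivWithin_zero]
    exact (solve_eqOn hT.le hw ⟨hx, ht⟩).symm
  · rw [iteratedDerivWithin_one_eqOn hT h₀ ht]
    exact (greenX_primT hT.le hw ⟨hx, ht⟩).symm
  · exact iteratedDerivWithin_two_eqOn hT h₀ h₁ ht

theorem pd_solve (hT : 0 < T) (hw : MemWhat T w) {i j : ℕ} (hi : i ≤ 2) (hj : j ≤ 2) :
    EqOn (pd T i j (solve w)) (opX i (opT j w)) (rect T) := by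
  rintro ⟨x, t⟩ ⟨hx, ht⟩
  have hv := hw.opT hT.le j
  have e : EqOn (fun x => pd T 0 j (solve w) (x, t)) (fun x => greenX (opT j w) (x, t))
    (Icc 0 1) := fun y hy => pd_zero_solve hT hw hj ⟨hy, ht⟩
  have h₀ : ∀ y ∈ Icc (0 : ℝ) 1, HasDerivWithinAt (fun x => greenX (opT j w) (x, t))
      (greenX' (opT j w) (y, t)) (Icc 0 1) y := fun y hy =>
    hasDerivWithinAt_primX (hv.greenX' hT.le).continuousOn hy ht
  have h₁ : ∀ y ∈ Icc (0 : ℝ) 1, HasDerivWithinAt (fun x => greenX' (opT j w) (x, t))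
      (opT j w (y, t)) (Icc 0 1) y := fun y hy => hasDerivWithinAt_greenX' hv.continuousOn hy ht
  rw [← congrFun (iteratedDerivWithin_pd T j i (solve w) t) x, iteratedDerivWithin_congr e hx]
  interval_cases i
  · rw [iteratedDerivWithin_zero]
    rfl
  · exact iteratedDerivWithin_one_eqOn one_pos h₀ hx
  · exact iteratedDerivWithin_two_eqOn one_pos h₀ h₁ hx

theorem memWhat_pd (hT : 0 < T) (hw : MemWhat T w) (hu : EqOn u (solve w) (rect T)) {i j : ℕ}
    (hi : i ≤ 2) (hj : j ≤ 2) : MemWhat T (pd T i j u) :=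
  ((hw.opT hT.le j).opX hT.le i).congr hT.le
    ((pd_congr hu i j).trans (pd_solve hT hw hi hj)).symm

/-- All derivatives `∂ₓⁱ∂ₜʲu` with `i, j ≤ 2` lie in `Ŵ(Ω)`, which yields the continuity and
integrability conditions; the homogeneous conditions are built into `primT` and `greenX`. -/
theorem memW_of_eqOn_solve (hT : 0 < T) (hw : MemWhat T w) (hu : EqOn u (solve w) (rect T)) :
    MemW T u := by
  have hpd : ∀ {i j : ℕ}, i ≤ 2 → j ≤ 2 → EqOn (pd T i j u) (opX i (opT j w)) (rect T) :=
    fun hi hj => (pd_congr hu _ _).trans (pd_solve hT hw hi hj)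
  have hv := hw.greenX hT.le
  have hz : (0 : ℝ) ∈ Icc 0 T := left_mem_Icc.2 hT.le
  have h22 := memWhat_pd hT hw hu le_rfl le_rfl
  refine ⟨fun x hx => ?_, fun j hj t ht => ?_, fun i hi j hj =>
    (memWhat_pd hT hw hu hi hj).continuousOn, h22.completelyContinuous, h22.memLp_mixed,
    fun i hi => (memWhat_pd hT hw hu hi le_rfl).memLp_edge, fun j hj => ⟨fun k hk => ?_, ?_, ?_, ?_⟩,
    fun x hx => ?_, fun x hx => ?_, fun t ht => ?_, fun t ht => ?_⟩
  · refine (contDiffOn_two_of_hasDerivWithinAt hT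
      (fun s hs => hasDerivWithinAt_primT (hv.primT hT.le).continuousOn hx hs)
      (fun s hs => hasDerivWithinAt_primT hv.continuousOn hx hs)
      (continuousOn_section_t hv.continuousOn hx)).congr fun s hs => ?_
    exact (hu ⟨hx, hs⟩).trans (solve_eqOn hT.le hw ⟨hx, hs⟩)
  · have hj' := hw.opT hT.le j
    refine (contDiffOn_two_of_hasDerivWithinAt one_pos
      (fun y hy => hasDerivWithinAt_primX (hj'.greenX' hT.le).continuousOn hy ht)
      (fun y hy => hasDerivWithinAt_greenX' hj'.continuousOn hy ht)
      (continuousOn_section_x hj'.continuousOn ht)).congr fun y hy => ?_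
    exact hpd zero_le_two hj ⟨hy, ht⟩
  · rw [iteratedDerivWithin_pd]
    exact (memWhat_pd hT hw hu hk hj).completelyContinuous.1
  · rw [iteratedDerivWithin_succ, iteratedDerivWithin_pd]
    exact (memWhat_pd hT hw hu le_rfl hj).trace_mem.2
  · exact (hpd zero_le_two hj ⟨left_mem_Icc.2 zero_le_one, hz⟩).trans (greenX_left _ _)
  · exact (hpd zero_le_two hj ⟨right_mem_Icc.2 zero_le_one, hz⟩).trans
      (greenX_right hT.le (hw.opT hT.le j) hz)
  · exact (hu ⟨hx, hz⟩).trans (greenX_bottom (opT_bottom w zero_lt_two) x)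
  · exact (hpd zero_le_two one_le_two ⟨hx, hz⟩).trans (greenX_bottom (opT_bottom w one_lt_two) x)
  · exact (hu ⟨left_mem_Icc.2 zero_le_one, ht⟩).trans (greenX_left _ _)
  · exact (hu ⟨right_mem_Icc.2 zero_le_one, ht⟩).trans
      (greenX_right hT.le (hw.opT hT.le 0) ht)

/-! ### Recovering a function of `W(Ω)` from `∂ₓ²∂ₜ²u` -/

theorem MemW.memWhat_pd (hu : MemW T u) : MemWhat T (pd T 2 2 u) := by
  refine ⟨hu.completelyContinuous, hu.memLp_mixed, hu.memLp_edge 2 le_rfl,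
    hu.completelyContinuous.1, ?_⟩
  have := (hu.trace_mem 2 le_rfl).2.1
  rwa [iteratedDerivWithin_succ, iteratedDerivWithin_pd] at this

theorem iteratedDerivWithin_eq_zero_of_eqOn {f : ℝ → ℝ} {s : Set ℝ} (h : ∀ x ∈ s, f x = 0) (n : ℕ)
    {x : ℝ} (hx : x ∈ s) : iteratedDerivWithin n f s x = 0 := by
  have e : EqOn f (fun _ => 0) s := h
  rw [iteratedDerivWithin_congr e hx]
  simp

theorem MemW.pd_zero_two_eqOn (hu : MemW T u) :
    EqOn (pd T 0 2 u) (greenX (pd T 2 2 u)) (rect T) := by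
  have key : ∀ t ∈ Icc 0 T, ∀ x ∈ Icc (0 : ℝ) 1, pd T 1 2 u (x, t) = greenX' (pd T 2 2 u) (x, t) ∧
      pd T 0 2 u (x, t) = greenX (pd T 2 2 u) (x, t) := by
    intro t ht
    have hc := hu.contDiff_x 2 le_rfl t ht
    have hd₀ : ∀ x ∈ Icc (0 : ℝ) 1, HasDerivWithinAt (fun x => pd T 0 2 u (x, t))
        (pd T 1 2 u (x, t)) (Icc 0 1) x := fun x hx => by
      simpa only [iteratedDerivWithin_pd] using
        hasDerivWithinAt_of_contDiffOn_two hc hx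
    have hd₁ : ∀ x ∈ Icc (0 : ℝ) 1, HasDerivWithinAt (fun x => pd T 1 2 u (x, t))
        (pd T 2 2 u (x, t)) (Icc 0 1) x := fun x hx => by
      simpa only [iteratedDerivWithin_pd] using
        hasDerivWithinAt_one_of_contDiffOn_two one_pos hc hx
    have hc1 := continuousOn_section_x (hu.continuous_pd 1 one_le_two 2 le_rfl) ht
    have hc2 := continuousOn_section_x (hu.continuous_pd 2 le_rfl 2 le_rfl) ht
    have e1 : ∀ x ∈ Icc (0 : ℝ) 1, pd T 1 2 u (x, t) =
        pd T 1 2 u (0, t) + primX (pd T 2 2 u) (x, t) := fun x hx =>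
      eq_add_integral_of_hasDerivWithinAt hd₁ hc2 hx
    have b : ∀ y, (∀ s ∈ Icc 0 T, u (y, s) = 0) → pd T 0 2 u (y, t) = 0 := by
      intro y hy
      simp only [pd, iteratedDerivWithin_zero]
      exact iteratedDerivWithin_eq_zero_of_eqOn hy 2 ht
    have b0 := b 0 hu.boundary_left
    have b1 := b 1 hu.boundary_right
    have e2 : ∀ x ∈ Icc (0 : ℝ) 1, pd T 0 2 u (x, t) = ∫ r in (0 : ℝ)..x, pd T 1 2 u (r, t) :=
      fun x hx => by
        have := eq_add_integral_of_hasDerivWithinAt hd₀ hc1 hx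
        rwa [b0, zero_add] at this
    have h1 : (1 : ℝ) ∈ Icc (0 : ℝ) 1 := right_mem_Icc.2 zero_le_one
    have hp : ContinuousOn (fun x => primX (pd T 2 2 u) (x, t)) (Icc 0 1) := fun x hx =>
      (hasDerivWithinAt_integral hc2 hx).continuousWithinAt
    -- The condition at `x = 1` fixes the integration constant `∂ₓ∂ₜ²u(0,t)`; this is the trace term
    -- subtracted in `greenX'`.
    have e3 : 0 = pd T 1 2 u (0, t) + primX (primX (pd T 2 2 u)) (1, t) := by
      refine (b1.symm.trans (e2 1 h1)).trans ?_
      rw [intervalIntegral.integral_congr (g := fun r =>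
        pd T 1 2 u (0, t) + primX (pd T 2 2 u) (r, t)), intervalIntegral.integral_add
        intervalIntegrable_const (hp.intervalIntegrable_of_Icc zero_le_one)]
      · simp [primX]
      · intro r hr
        rw [uIcc_of_le zero_le_one] at hr
        exact e1 r hr
    have e4 : ∀ x ∈ Icc (0 : ℝ) 1, pd T 1 2 u (x, t) = greenX' (pd T 2 2 u) (x, t) :=
      fun x hx => by
        rw [e1 x hx]
        simp only [greenX', traceX, Pi.sub_apply]
        linarith
    refine fun x hx => ⟨e4 x hx, ?_⟩
    rw [e2 x hx]
    refine intervalIntegral.integral_congr fun r hr => ?_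
    rw [uIcc_of_le hx.1] at hr
    exact e4 r ⟨hr.1, hr.2.trans hx.2⟩
  rintro ⟨x, t⟩ ⟨hx, ht⟩
  exact (key t ht x hx).2

theorem MemW.eqOn_solve (hT : 0 < T) (hu : MemW T u) : EqOn u (solve (pd T 2 2 u)) (rect T) := by
  rintro ⟨x, t⟩ ⟨hx, ht⟩
  rw [solve_eqOn hT.le hu.memWhat_pd ⟨hx, ht⟩,
    ← primT_congr (primT_congr hu.pd_zero_two_eqOn) ⟨hx, ht⟩]
  have hc := hu.contDiff_t x hx
  have e (j : ℕ) : iteratedDerivWithin j (fun t => u (x, t)) (Icc 0 T) =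
      fun t => pd T 0 j u (x, t) := by simp [pd]
  have hd₀ : ∀ s ∈ Icc (0 : ℝ) T, HasDerivWithinAt (fun t => u (x, t))
      (pd T 0 1 u (x, s)) (Icc 0 T) s := fun s hs => by
    simpa only [e] using hasDerivWithinAt_of_contDiffOn_two hc hs
  have hd₁ : ∀ s ∈ Icc (0 : ℝ) T, HasDerivWithinAt (fun t => pd T 0 1 u (x, t))
      (pd T 0 2 u (x, s)) (Icc 0 T) s := fun s hs => by
    simpa only [e] using hasDerivWithinAt_one_of_contDiffOn_two hT hc hs
  have hc1 := continuousOn_section_t (hu.continuous_pd 0 zero_le_two 1 one_le_two) hx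
  have hc2 := continuousOn_section_t (hu.continuous_pd 0 zero_le_two 2 le_rfl) hx
  have e1 : ∀ s ∈ Icc (0 : ℝ) T, pd T 0 1 u (x, s) = primT (pd T 0 2 u) (x, s) := fun s hs => by
    have := eq_add_integral_of_hasDerivWithinAt hd₁ hc2 hs
    rwa [hu.initial_deriv x hx, zero_add] at this
  have e2 := eq_add_integral_of_hasDerivWithinAt hd₀ hc1 ht
  rw [hu.initial x hx, zero_add] at e2
  rw [e2]
  refine intervalIntegral.integral_congr fun s hs => ?_
  rw [uIcc_of_le ht.1] at hs
  exact e1 s ⟨hs.1, hs.2.trans ht.2⟩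

theorem memW_iff (hT : 0 < T) :
    MemW T u ↔ ∃ h : Data T, EqOn u (solve h.toFun) (rect T) := by
  constructor
  · intro hu
    obtain ⟨h, hh⟩ := Data.exists_of_memWhat hu.memWhat_pd
    exact ⟨h, (hu.eqOn_solve hT).trans (greenX_congr (primT_congr (primT_congr hh)))⟩
  · rintro ⟨h, hh⟩
    exact memW_of_eqOn_solve hT (h.toFun_memWhat hT.le) hh

variable {T : ℝ} {f g u w : ℝ × ℝ → ℝ}

/-! ### Uniqueness for the wave equation -/

theorem waveOp_congr {u v : ℝ × ℝ → ℝ} (h : EqOn u v (rect T)) :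
    EqOn (waveOp T u) (waveOp T v) (rect T) := fun z hz => by
  simp only [waveOp, pd_congr h _ _ hz]

theorem waveOp_solve (hT : 0 < T) (hw : MemWhat T w) :
    EqOn (waveOp T (solve w)) (greenX w - primT (primT w)) (rect T) := fun z hz => by
  rw [waveOp, pd_solve hT hw zero_le_two le_rfl hz, pd_solve hT hw le_rfl zero_le_two hz]
  rfl

/-- Conservation of the energy `∫₀¹ (uₜ² + uₓ²) dx`, which is zero at `t = 0`. The identity is used
in integrated form, so Fubini replaces differentiation under the integral sign. -/
theorem solve_eq_zero_of_waveOp (hT : 0 < T) (hw : MemWhat T w)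
    (h : ∀ z ∈ rect T, waveOp T (solve w) z = 0) : ∀ z ∈ rect T, solve w z = 0 := by
  have h0 : (0 : ℝ) ∈ Icc (0 : ℝ) 1 := left_mem_Icc.2 zero_le_one
  have h1 : (1 : ℝ) ∈ Icc (0 : ℝ) 1 := right_mem_Icc.2 zero_le_one
  -- For `u = solve w`: `q = uₓₓ`, `a = uₜ`, `b = uₓ`, `d = uₓₜ`; the wave equation says that
  -- `greenX w = uₜₜ` equals `q`.
  set q := primT (primT w) with hq
  set a := greenX (primT w) with ha
  set b := greenX' q with hb
  set d := greenX' (primT w) with hd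
  have hQ := hw.primT hT.le
  have hqc := (hQ.primT hT.le).continuousOn
  have hac := (hQ.greenX hT.le).continuousOn
  have hbc := ((hQ.primT hT.le).greenX' hT.le).continuousOn
  have hdc := (hQ.greenX' hT.le).continuousOn
  have hgc := (hw.greenX hT.le).continuousOn
  have hpq : EqOn (greenX w) q (rect T) := fun z hz => by
    have := waveOp_solve hT hw hz
    rw [h z hz, Pi.sub_apply] at this
    linarith
  have hat : EqOn a (primT (greenX w)) (rect T) := greenX_primT hT.le hw
  have hbt : EqOn b (primT d) (rect T) := greenX'_primT hT.le hQ
  -- `F` is both `∂ₜ(uₜ² + uₓ²)` and `∂ₓ(2uₜuₓ)`. Its `t`-primitive is the energy density, and its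
  -- integral over `0 ≤ x ≤ 1` vanishes since `uₜ = 0` at both ends.
  let F : ℝ × ℝ → ℝ := fun z => 2 * (a z * q z + b z * d z)
  have hF : ContinuousOn F (rect T) := by fun_prop
  have hFt : EqOn (primT F) (fun z => a z ^ 2 + b z ^ 2) (rect T) := by
    rintro ⟨x, t⟩ ⟨hx, ht⟩
    have hd₀ : ∀ s ∈ Icc 0 T, HasDerivWithinAt (fun s => a (x, s) ^ 2 + b (x, s) ^ 2)
        (F (x, s)) (Icc 0 T) s := fun s hs => by
      have e1 : HasDerivWithinAt (fun s => a (x, s)) (q (x, s)) (Icc 0 T) s := by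
        rw [← hpq (x := (x, s)) ⟨hx, hs⟩]
        exact (hasDerivWithinAt_primT hgc hx hs).congr (fun r hr => hat ⟨hx, hr⟩) (hat ⟨hx, hs⟩)
      have e2 : HasDerivWithinAt (fun s => b (x, s)) (d (x, s)) (Icc 0 T) s :=
        (hasDerivWithinAt_primT hdc hx hs).congr (fun r hr => hbt ⟨hx, hr⟩) (hbt ⟨hx, hs⟩)
      refine ((e1.pow 2).add (e2.pow 2)).congr_deriv ?_
      simp only [F]
      push_cast
      ring
    have := eq_add_integral_of_hasDerivWithinAt hd₀ (continuousOn_section_t hF hx) ht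
    have ha0 : a (x, 0) = 0 := greenX_bottom (opT_bottom w one_lt_two) x
    have hb0 : b (x, 0) = 0 := by
      simp [hb, hq, greenX', SineGordonRK.primX, SineGordonRK.primT, traceX]
    simp only [ha0, hb0] at this
    change primT F (x, t) = a (x, t) ^ 2 + b (x, t) ^ 2
    rw [this]
    simp [SineGordonRK.primT]
  have hFx : ∀ t ∈ Icc 0 T, primX F (1, t) = 0 := by
    intro t ht
    have hd₀ : ∀ y ∈ Icc (0 : ℝ) 1, HasDerivWithinAt (fun y => 2 * (a (y, t) * b (y, t)))
        (F (y, t)) (Icc 0 1) y := fun y hy => by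
      have e1 : HasDerivWithinAt (fun y => a (y, t)) (d (y, t)) (Icc 0 1) y :=
        hasDerivWithinAt_primX hdc hy ht
      have e2 : HasDerivWithinAt (fun y => b (y, t)) (q (y, t)) (Icc 0 1) y :=
        hasDerivWithinAt_greenX' hqc hy ht
      refine ((e1.mul e2).const_mul 2).congr_deriv ?_
      simp only [F]
      ring
    have := eq_add_integral_of_hasDerivWithinAt hd₀ (continuousOn_section_x hF ht) h1
    have ha0 : a (0, t) = 0 := greenX_left _ _
    have ha1 : a (1, t) = 0 := greenX_right hT.le hQ ht
    simp only [ha0, ha1] at this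
    simpa [SineGordonRK.primX] using this.symm
  have hzero : ∀ t ∈ Icc 0 T, ∀ x ∈ Icc (0 : ℝ) 1, b (x, t) = 0 := by
    intro t ht x hx
    have e : ∫ x in (0 : ℝ)..1, (a (x, t) ^ 2 + b (x, t) ^ 2) = 0 := by
      have e1 : primX (primT F) (1, t) = 0 := by
        rw [primX_primT hF ⟨h1, ht⟩]
        simp only [SineGordonRK.primT]
        rw [intervalIntegral.integral_congr (g := fun _ => 0)]
        · simp
        · intro s hs
          rw [uIcc_of_le ht.1] at hs
          exact hFx s ⟨hs.1, hs.2.trans ht.2⟩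
      refine Eq.trans ?_ e1
      refine intervalIntegral.integral_congr fun r hr => ?_
      rw [uIcc_of_le zero_le_one] at hr
      exact (hFt ⟨hr, ht⟩).symm
    by_contra hne
    have hc : ContinuousOn (fun x => a (x, t) ^ 2 + b (x, t) ^ 2) (Icc 0 1) :=
      ((continuousOn_section_x hac ht).pow 2).add ((continuousOn_section_x hbc ht).pow 2)
    exact (intervalIntegral.integral_pos one_pos hc (fun y _ => by positivity)
      ⟨x, hx, by positivity⟩).ne' e
  rintro ⟨x, t⟩ ⟨hx, ht⟩
  change ∫ r in (0 : ℝ)..x, b (r, t) = 0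
  rw [intervalIntegral.integral_congr (g := fun _ => 0)]
  · simp
  · intro r hr
    rw [uIcc_of_le hx.1] at hr
    exact hzero t ht r ⟨hr.1, hr.2.trans hx.2⟩

/-! ### Bounded operators on `Ŵ(Ω)` -/

/-- The operator `Φ` acts on `Ŵ(Ω)` as a bounded operator. -/
def IsBddOp (T : ℝ) (Φ : (ℝ × ℝ → ℝ) → ℝ × ℝ → ℝ) : Prop :=
  ∃ M : Data T →L[ℝ] Data T, ∀ h, EqOn (Φ h.toFun) (M h).toFun (rect T)

theorem IsBddOp.comp {Φ Ψ : (ℝ × ℝ → ℝ) → ℝ × ℝ → ℝ} (hΨ : IsBddOp T Ψ) (hΦ : IsBddOp T Φ)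
    (hc : ∀ {f g}, EqOn f g (rect T) → EqOn (Ψ f) (Ψ g) (rect T)) :
    IsBddOp T fun f => Ψ (Φ f) := by
  obtain ⟨M, hM⟩ := hΦ
  obtain ⟨N, hN⟩ := hΨ
  exact ⟨N.comp M, fun h => (hc (hM h)).trans (hN _)⟩

theorem IsBddOp.sub {Φ Ψ : (ℝ × ℝ → ℝ) → ℝ × ℝ → ℝ} (hΨ : IsBddOp T Ψ) (hΦ : IsBddOp T Φ) :
    IsBddOp T fun f => Ψ f - Φ f := by
  obtain ⟨M, hM⟩ := hΦ
  obtain ⟨N, hN⟩ := hΨ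
  refine ⟨N - M, fun h z hz => ?_⟩
  simp [Data.toFun_sub, hM h hz, hN h hz]

theorem isBddOp_primX (hT : 0 ≤ T) : IsBddOp T primX := by
  refine exists_clm hT _ (fun h => (h.toFun_memWhat hT).primX hT) ?_
  rintro ⟨x, t⟩ ⟨hx, ht⟩
  have hc : ContinuousOn (fun r => Data.eval T (r, t)) (Icc 0 x) :=
    Data.continuousOn_eval.comp (by fun_prop) fun r hr => ⟨⟨hr.1, hr.2.trans hx.2⟩, ht⟩
  -- The value of the primitive is the inner product with the Bochner integral of the evaluation
  -- vectors.
  refine ⟨innerSL ℝ (∫ r in (0 : ℝ)..x, Data.eval T (r, t)), fun h => ?_⟩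
  have := (innerSL ℝ h).intervalIntegral_comp_comm (hc.intervalIntegrable_of_Icc (μ := volume) hx.1)
  rw [innerSL_apply_apply, real_inner_comm, ← innerSL_apply_apply ℝ, ← this]
  refine intervalIntegral.integral_congr fun r _ => ?_
  exact real_inner_comm _ _

theorem isBddOp_primT (hT : 0 ≤ T) : IsBddOp T primT := by
  refine exists_clm hT _ (fun h => (h.toFun_memWhat hT).primT hT) ?_
  rintro ⟨x, t⟩ ⟨hx, ht⟩
  have hc : ContinuousOn (fun r => Data.eval T (x, r)) (Icc 0 t) :=
    Data.continuousOn_eval.comp (by fun_prop) fun r hr => ⟨hx, ⟨hr.1, hr.2.trans ht.2⟩⟩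
  refine ⟨innerSL ℝ (∫ r in (0 : ℝ)..t, Data.eval T (x, r)), fun h => ?_⟩
  have := (innerSL ℝ h).intervalIntegral_comp_comm (hc.intervalIntegrable_of_Icc (μ := volume) ht.1)
  rw [innerSL_apply_apply, real_inner_comm, ← innerSL_apply_apply ℝ, ← this]
  refine intervalIntegral.integral_congr fun r _ => ?_
  exact real_inner_comm _ _

theorem isBddOp_traceX (hT : 0 ≤ T) : IsBddOp T (traceX 1) :=
  exists_clm hT _ (fun h => (h.toFun_rep.traceX_right zero_le_one hT).memWhat hT)
    fun z _ => ⟨innerSL ℝ (Data.eval T (1, z.2)), fun _ => rfl⟩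

theorem isBddOp_greenX' (hT : 0 ≤ T) : IsBddOp T greenX' :=
  (isBddOp_primX hT).sub ((isBddOp_traceX hT).comp
    ((isBddOp_primX hT).comp (isBddOp_primX hT) primX_congr)
    fun h _ hz => h ⟨right_mem_Icc.2 zero_le_one, hz.2⟩)

theorem isBddOp_greenX (hT : 0 ≤ T) : IsBddOp T greenX :=
  (isBddOp_primX hT).comp (isBddOp_greenX' hT) primX_congr

theorem isBddOp_solve (hT : 0 ≤ T) : IsBddOp T solve :=
  (isBddOp_greenX hT).comp ((isBddOp_primT hT).comp (isBddOp_primT hT) primT_congr) greenX_congr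

theorem isBddOp_waveOp_solve (hT : 0 < T) : IsBddOp T fun w => waveOp T (solve w) := by
  obtain ⟨M, hM⟩ := (isBddOp_greenX hT.le).sub
    ((isBddOp_primT hT.le).comp (isBddOp_primT hT.le) primT_congr)
  exact ⟨M, fun h => (waveOp_solve hT (h.toFun_memWhat hT.le)).trans (hM h)⟩

/-! ### The inner product of `W(Ω)` -/

theorem integral_mul_eq_inner {X : Type*} [MeasurableSpace X] {μ : Measure X} {φ ψ : X → ℝ}
    {a b : Lp ℝ 2 μ} (ha : φ =ᵐ[μ] a) (hb : ψ =ᵐ[μ] b) : ∫ x, φ x * ψ x ∂μ = inner ℝ a b := by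
  rw [L2.inner_def]
  refine integral_congr_ae ?_
  filter_upwards [ha, hb] with x h1 h2
  rw [h1, h2]
  exact mul_comm _ _

theorem integral_edgeDeriv_mul (hT : 0 ≤ T) {h k : Data T} (hf : EqOn f h.toFun (rect T))
    (hg : EqOn g k.toFun (rect T)) :
    ∫ t in (0 : ℝ)..T, edgeDeriv T f t * edgeDeriv T g t = inner ℝ h.right k.right := by
  have hf' : Rep 1 T f _ _ _ _ := h.toFun_rep.congr hf.symm
  have hg' : Rep 1 T g _ _ _ _ := k.toFun_rep.congr hg.symm
  rw [intervalIntegral.integral_of_le hT, ← integral_Icc_eq_integral_Ioc]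
  exact integral_mul_eq_inner (hf'.edgeDeriv_ae_eq hT) (hg'.edgeDeriv_ae_eq hT)

theorem integral_derivWithin_mul (hT : 0 ≤ T) {h k : Data T} (hf : EqOn f h.toFun (rect T))
    (hg : EqOn g k.toFun (rect T)) :
    ∫ x in (0 : ℝ)..1, derivWithin (fun x => f (x, 0)) (Icc 0 1) x *
      derivWithin (fun x => g (x, 0)) (Icc 0 1) x = inner ℝ h.left k.left := by
  have hf' : Rep 1 T f _ _ _ _ := h.toFun_rep.congr hf.symm
  have hg' : Rep 1 T g _ _ _ _ := k.toFun_rep.congr hg.symm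
  rw [intervalIntegral.integral_of_le zero_le_one, ← integral_Icc_eq_integral_Ioc]
  exact integral_mul_eq_inner (hf'.derivWithin_ae_eq hT) (hg'.derivWithin_ae_eq hT)

theorem integral_mixedDeriv_mul (hT : 0 ≤ T) {h k : Data T} (hf : EqOn f h.toFun (rect T))
    (hg : EqOn g k.toFun (rect T)) :
    ∫ q in rect T, mixedDeriv T f q * mixedDeriv T g q = inner ℝ h.mixed k.mixed := by
  have hf' : Rep 1 T f _ _ _ _ := h.toFun_rep.congr hf.symm
  have hg' : Rep 1 T g _ _ _ _ := k.toFun_rep.congr hg.symm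
  exact integral_mul_eq_inner (hf'.mixedDeriv_ae_eq hT) (hg'.mixedDeriv_ae_eq hT)

theorem innerW23_eq_zero {f : ℝ → ℝ} (hf : ∀ x ∈ Icc (0 : ℝ) 1, f x = 0) (g : ℝ → ℝ) :
    innerW23 f g = 0 := by
  have h0 : (0 : ℝ) ∈ Icc (0 : ℝ) 1 := left_mem_Icc.2 zero_le_one
  have h1 : (1 : ℝ) ∈ Icc (0 : ℝ) 1 := right_mem_Icc.2 zero_le_one
  have e : ∫ x in (0 : ℝ)..1, iteratedDerivWithin 3 f (Icc 0 1) x *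
      iteratedDerivWithin 3 g (Icc 0 1) x = 0 := by
    rw [intervalIntegral.integral_congr (g := fun _ => 0)]
    · simp
    · intro x hx
      rw [uIcc_of_le zero_le_one] at hx
      simp [iteratedDerivWithin_eq_zero_of_eqOn hf 3 hx]
  rw [innerW23, e, ← iteratedDerivWithin_one, iteratedDerivWithin_eq_zero_of_eqOn hf 1 h0,
    iteratedDerivWithin_eq_zero_of_eqOn hf 1 h1, hf 0 h0]
  simp

/-- With `w = ∂ₓ²∂ₜ²u` the edge term `i = 0` vanishes by the boundary condition and the traces `j =
0, 1` by the initial conditions. The term `i = 1` and the two end slopes in the trace `j = 2` come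
from `∂ₓ∂ₜ²u = greenX' w`. The rest is the inner product of the data without the product of the
values at the origin. -/
theorem innerW_eq (hT : 0 < T) {A : Data T →L[ℝ] Data T}
    (hA : ∀ h, EqOn (greenX' h.toFun) (A h).toFun (rect T)) {u v : ℝ × ℝ → ℝ} {h k : Data T}
    (hu : EqOn u (solve h.toFun) (rect T)) (hv : EqOn v (solve k.toFun) (rect T)) :
    innerW T u v = inner ℝ (A h).right (A k).right + (A h).toFun (0, 0) * (A k).toFun (0, 0) +
      (A h).toFun (1, 0) * (A k).toFun (1, 0) + (inner ℝ h k - h.value * k.value) := by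
  have hz : (0 : ℝ) ∈ Icc 0 T := left_mem_Icc.2 hT.le
  have h0 : (0 : ℝ) ∈ Icc (0 : ℝ) 1 := left_mem_Icc.2 zero_le_one
  have h1 : (1 : ℝ) ∈ Icc (0 : ℝ) 1 := right_mem_Icc.2 zero_le_one
  have hpd : ∀ {u : ℝ × ℝ → ℝ} {h : Data T} {i j : ℕ}, EqOn u (solve h.toFun) (rect T) → i ≤ 2 →
      j ≤ 2 → EqOn (pd T i j u) (opX i (opT j h.toFun)) (rect T) := fun hu hi hj =>
    (pd_congr hu _ _).trans (pd_solve hT (Data.toFun_memWhat hT.le _) hi hj)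
  have hp1 : ∀ {u : ℝ × ℝ → ℝ} {h : Data T}, EqOn u (solve h.toFun) (rect T) →
      EqOn (pd T 1 2 u) (A h).toFun (rect T) := fun hu =>
    (hpd hu one_le_two le_rfl).trans (hA _)
  have hp2 : ∀ {u : ℝ × ℝ → ℝ} {h : Data T}, EqOn u (solve h.toFun) (rect T) →
      EqOn (pd T 2 2 u) h.toFun (rect T) := fun hu => hpd hu le_rfl le_rfl
  have hi0 : ∫ t in (0 : ℝ)..T, edgeDeriv T (pd T 0 2 u) t * edgeDeriv T (pd T 0 2 v) t = 0 := by
    rw [intervalIntegral.integral_congr (g := fun _ => 0)]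
    · simp
    · intro t ht
      rw [uIcc_of_le hT.le] at ht
      have : edgeDeriv T (pd T 0 2 u) t = 0 := by
        rw [edgeDeriv, ← iteratedDerivWithin_one]
        exact iteratedDerivWithin_eq_zero_of_eqOn (fun s hs =>
          (hpd hu zero_le_two le_rfl ⟨h0, hs⟩).trans (greenX_left _ _)) 1 ht
      simp [this]
  have hj : ∀ j < 2, innerW23 (fun x => pd T 0 j u (x, 0)) (fun x => pd T 0 j v (x, 0)) = 0 :=
    fun j hj => innerW23_eq_zero (fun x hx => (hpd hu zero_le_two hj.le ⟨hx, hz⟩).trans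
      (greenX_bottom (opT_bottom _ hj) x)) _
  have hj2 : innerW23 (fun x => pd T 0 2 u (x, 0)) (fun x => pd T 0 2 v (x, 0)) =
      (A h).toFun (0, 0) * (A k).toFun (0, 0) + (A h).toFun (1, 0) * (A k).toFun (1, 0) +
        inner ℝ h.left k.left := by
    have e0 : pd T 0 2 u (0, 0) = 0 := (hpd hu zero_le_two le_rfl ⟨h0, hz⟩).trans (greenX_left _ _)
    rw [innerW23, ← iteratedDerivWithin_one, ← iteratedDerivWithin_one,
      iteratedDerivWithin_succ (n := 2), iteratedDerivWithin_succ (n := 2)]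
    simp only [iteratedDerivWithin_pd]
    rw [e0, hp1 hu ⟨h0, hz⟩, hp1 hu ⟨h1, hz⟩, hp1 hv ⟨h0, hz⟩, hp1 hv ⟨h1, hz⟩,
      integral_derivWithin_mul hT.le (hp2 hu) (hp2 hv)]
    ring
  rw [innerW, integral_mixedDeriv_mul hT.le (hp2 hu) (hp2 hv)]
  simp only [Finset.sum_range_succ, Finset.sum_range_zero]
  rw [hi0, hj 0 zero_lt_two, hj 1 one_lt_two, hj2, integral_edgeDeriv_mul hT.le (hp1 hu) (hp1 hv),
    integral_edgeDeriv_mul hT.le (hp2 hu) (hp2 hv), Data.inner_eq h k]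
  ring

/-- Cauchy–Schwarz against the indicator of `[0,x]`, whose squared norm is `x ≤ 1`. -/
theorem Data.abs_toFun_sub_value_le (h : Data T) (hT : 0 ≤ T) {x : ℝ} (hx : x ∈ Icc (0 : ℝ) 1) :
    |h.toFun (x, 0) - h.value| ≤ ‖h.left‖ := by
  have hm : (x, (0 : ℝ)) ∈ rect T := ⟨hx, left_mem_Icc.2 hT⟩
  rw [h.toFun_rep.eq_edge_x hT hx, add_sub_cancel_left, ← h.inner_left_eval hx 0]
  refine (abs_real_inner_le_norm _ _).trans (mul_le_of_le_one_left (norm_nonneg _) ?_)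
  have e := inner_left_eval_eval hm hm
  rw [real_inner_self_eq_norm_sq, min_self] at e
  nlinarith [norm_nonneg (left (eval T (x, 0))), hx.2]

/-- Controls the one component of the data missing from the form. The end slopes differ by `∫₀¹
w(r,0) dr`, which is within `‖h.left‖` of `w(0,0)`. -/
theorem Data.sq_value_le (hT : 0 ≤ T) {A : Data T →L[ℝ] Data T}
    (hA : ∀ h, EqOn (greenX' h.toFun) (A h).toFun (rect T)) (h : Data T) :
    h.value ^ 2 ≤ 3 * ((A h).toFun (0, 0) ^ 2 + (A h).toFun (1, 0) ^ 2 + ‖h.left‖ ^ 2) := by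
  have hz : (0 : ℝ) ∈ Icc 0 T := left_mem_Icc.2 hT
  have h0 : (0 : ℝ) ∈ Icc (0 : ℝ) 1 := left_mem_Icc.2 zero_le_one
  have h1 : (1 : ℝ) ∈ Icc (0 : ℝ) 1 := right_mem_Icc.2 zero_le_one
  have e : (A h).toFun (1, 0) - (A h).toFun (0, 0) = ∫ r in (0 : ℝ)..1, h.toFun (r, 0) := by
    rw [← hA h (x := (0, 0)) ⟨h0, hz⟩, ← hA h (x := (1, 0)) ⟨h1, hz⟩]
    simp [greenX', SineGordonRK.primX, traceX]
  have hi : IntervalIntegrable (fun r => h.toFun (r, 0)) volume 0 1 :=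
    (continuousOn_section_x h.continuousOn_toFun hz).intervalIntegrable_of_Icc zero_le_one
  have e2 : (∫ r in (0 : ℝ)..1, (h.toFun (r, 0) - h.value)) =
      (∫ r in (0 : ℝ)..1, h.toFun (r, 0)) - h.value := by
    rw [intervalIntegral.integral_sub hi intervalIntegrable_const]
    simp
  have e3 : |∫ r in (0 : ℝ)..1, (h.toFun (r, 0) - h.value)| ≤ ‖h.left‖ := by
    have := intervalIntegral.norm_integral_le_of_norm_le_const (a := (0 : ℝ)) (b := 1)
      (f := fun r => h.toFun (r, 0) - h.value) (C := ‖h.left‖) fun x hx => by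
        rw [uIoc_of_le zero_le_one] at hx
        exact h.abs_toFun_sub_value_le hT (Ioc_subset_Icc_self hx)
    simpa using this
  rw [e2, ← e] at e3
  set p := (A h).toFun (0, 0)
  set r := (A h).toFun (1, 0)
  -- With `e = r - p - h.value` the value is `r - p - e`, and `(r - p - e)² ≤ 3(r² + p² + e²)`.
  have e4 : (r - p - h.value) ^ 2 ≤ ‖h.left‖ ^ 2 := sq_le_sq.2 (by rwa [abs_of_nonneg (norm_nonneg _)])
  nlinarith [sq_nonneg (p + r), sq_nonneg (r - (r - p - h.value)), sq_nonneg
    (p - (r - p - h.value)), sq_nonneg (r + (r - p - h.value)), sq_nonneg (p + (r - p - h.value))]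

noncomputable section

/-- The inner product of a real Hilbert space as a bilinear form. -/
def innerBilin (E : Type*) [NormedAddCommGroup E] [InnerProductSpace ℝ E] : E →L[ℝ] E →L[ℝ] ℝ :=
  (isBoundedBilinearMap_inner (𝕜 := ℝ)).toContinuousLinearMap

/-- The product of two functionals. -/
def mulBilin {E : Type*} [NormedAddCommGroup E] [NormedSpace ℝ E] (l : E →L[ℝ] ℝ) :
    E →L[ℝ] E →L[ℝ] ℝ :=
  (ContinuousLinearMap.mul ℝ ℝ).bilinearComp l l

/-- The inner product of `W(Ω)` in terms of the data of `∂ₓ²∂ₜ²u`, where `A` is the operator that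
corresponds to `greenX'`. -/
def formW (A : Data T →L[ℝ] Data T) : Data T →L[ℝ] Data T →L[ℝ] ℝ :=
  (innerBilin _).bilinearComp (Data.right.comp A) (Data.right.comp A)
    + mulBilin ((innerSL ℝ (Data.eval T (0, 0))).comp A)
    + mulBilin ((innerSL ℝ (Data.eval T (1, 0))).comp A)
    + (innerBilin _ - mulBilin Data.value)

theorem formW_apply (A : Data T →L[ℝ] Data T) (h k : Data T) : formW A h k =
    inner ℝ (A h).right (A k).right + (A h).toFun (0, 0) * (A k).toFun (0, 0) +
      (A h).toFun (1, 0) * (A k).toFun (1, 0) + (inner ℝ h k - h.value * k.value) := by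
  rfl

theorem isCoercive_formW (hT : 0 ≤ T) {A : Data T →L[ℝ] Data T}
    (hA : ∀ h, EqOn (greenX' h.toFun) (A h).toFun (rect T)) : IsCoercive (formW A) := by
  -- The bound with factor `3` on the squared value, plus the squared norms already in the form,
  -- gives `‖h‖²` at most four times the form.
  refine ⟨1 / 4, by norm_num, fun h => ?_⟩
  have e := Data.inner_eq h h
  have e' := h.sq_value_le hT hA
  rw [formW_apply]
  simp only [real_inner_self_eq_norm_sq] at e ⊢
  nlinarith [sq_nonneg ‖h.mixed‖, sq_nonneg ‖h.right‖, sq_nonneg ‖(A h).right‖, sq_nonneg ‖h.left‖]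

end

/-! ### Coercive symmetric forms -/

section coercive

variable {E : Type*} [NormedAddCommGroup E] [InnerProductSpace ℝ E] {B : E →L[ℝ] E →L[ℝ] ℝ}

theorem eq_zero_of_form_self (hB : IsCoercive B) {h : E} (h0 : B h h = 0) : h = 0 := by
  obtain ⟨C, hC, H⟩ := hB
  have h1 := H h
  rw [h0, mul_assoc] at h1
  have h2 : ‖h‖ * ‖h‖ ≤ 0 := by
    by_contra hne
    push Not at hne
    exact absurd h1 (not_le.2 (mul_pos hC hne))
  exact norm_eq_zero.1 (mul_self_eq_zero.1 (le_antisymm h2 (mul_self_nonneg _)))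

variable [CompleteSpace E]

/-- Lax–Milgram: Riesz representation with respect to the form `B`. -/
theorem exists_form_eq_inner (hB : IsCoercive B) (hs : ∀ h k, B h k = B k h) (v : E) :
    ∃ m, ∀ h, B h m = inner ℝ h v := by
  refine ⟨hB.continuousLinearEquivOfBilin.symm v, fun h => ?_⟩
  rw [hs, ← hB.continuousLinearEquivOfBilin_apply, ContinuousLinearEquiv.apply_symm_apply,
    real_inner_comm]

/-- If `m` is orthogonal to the span in the original inner product, its Lax–Milgram representative
is `B`-orthogonal to every `k i`, hence zero, and so is `m`. The span is thus dense, and `B` is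
continuous. -/
theorem exists_mem_span_form_lt (hB : IsCoercive B) (hs : ∀ h k, B h k = B k h) {ι : Type*}
    {k : ι → E} (hk : ∀ h, (∀ i, B h (k i) = 0) → h = 0) (h : E) {ε : ℝ} (hε : 0 < ε) :
    ∃ v ∈ Submodule.span ℝ (range k), √(B (h - v) (h - v)) < ε := by
  have htop : (Submodule.span ℝ (range k)).topologicalClosure = ⊤ := by
    rw [Submodule.topologicalClosure_eq_top_iff, Submodule.eq_bot_iff]
    intro m hm
    obtain ⟨n, hn⟩ := exists_form_eq_inner hB hs m
    have h0 : n = 0 := hk n fun i => by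
      rw [hs, hn]
      exact (Submodule.mem_orthogonal _ _).1 hm _ (Submodule.subset_span ⟨i, rfl⟩)
    have := hn m
    rw [h0, map_zero] at this
    exact inner_self_eq_zero.1 this.symm
  have hcl : h ∈ closure (Submodule.span ℝ (range k) : Set E) := by
    rw [← Submodule.topologicalClosure_coe, htop]
    trivial
  have hc : Continuous fun v => √(B (h - v) (h - v)) := by fun_prop
  have ho : IsOpen {v | √(B (h - v) (h - v)) < ε} := isOpen_lt hc continuous_const
  obtain ⟨v, hv, hvs⟩ := mem_closure_iff.1 hcl _ ho (by simpa using hε)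
  exact ⟨v, hvs, hv⟩

end coercive

/-! ### The wave operator, its adjoint and the reproducing kernel of `W(Ω)` -/

variable {T : ℝ}

theorem exists_form_innerW (hT : 0 < T) : ∃ B : Data T →L[ℝ] Data T →L[ℝ] ℝ,
    IsCoercive B ∧ (∀ h k, B h k = B k h) ∧ ∀ {u v : ℝ × ℝ → ℝ} {h k : Data T},
      EqOn u (solve h.toFun) (rect T) → EqOn v (solve k.toFun) (rect T) →
        innerW T u v = B h k := by
  obtain ⟨A, hA⟩ := isBddOp_greenX' hT.le
  refine ⟨formW A, isCoercive_formW hT.le hA, fun h k => ?_, fun hu hv => ?_⟩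
  · rw [formW_apply, formW_apply, real_inner_comm, real_inner_comm h k]
    ring
  · rw [innerW_eq hT hA hu hv, formW_apply]

theorem innerW_comm (T : ℝ) (u v : ℝ × ℝ → ℝ) : innerW T u v = innerW T v u := by
  simp only [innerW, innerW23, mul_comm]

theorem memW_solve (hT : 0 < T) (h : Data T) : MemW T (solve h.toFun) :=
  (memW_iff hT).2 ⟨h, fun _ _ => rfl⟩

theorem memWhat_waveOp (hT : 0 < T) {u : ℝ × ℝ → ℝ} (hu : MemW T u) :
    MemWhat T (waveOp T u) := by
  obtain ⟨h, hh⟩ := (memW_iff hT).1 hu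
  obtain ⟨L, hL⟩ := isBddOp_waveOp_solve hT
  exact ((L h).toFun_memWhat hT.le).congr hT.le ((waveOp_congr hh).trans (hL h)).symm

theorem exists_isAdjoint (hT : 0 < T) : ∃ Ladj, IsAdjoint T Ladj := by
  obtain ⟨B, hB, hs, hBi⟩ := exists_form_innerW hT
  obtain ⟨L, hL⟩ := isBddOp_waveOp_solve hT
  have key : ∀ f, ∃ g, MemWhat T f →
      MemW T g ∧ ∀ u ∈ W T, innerWhat T (waveOp T u) f = innerW T u g := by
    intro f
    by_cases hf : MemWhat T f
    · obtain ⟨k, hk⟩ := Data.exists_of_memWhat hf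
      -- `L*` is the Hilbert space adjoint on `Data T`, corrected by Lax–Milgram for the inner
      -- product of `W(Ω)`.
      obtain ⟨m, hm⟩ := exists_form_eq_inner hB hs (ContinuousLinearMap.adjoint L k)
      refine ⟨solve m.toFun, fun _ => ⟨memW_solve hT m, fun u hu => ?_⟩⟩
      obtain ⟨h, hh⟩ := (memW_iff hT).1 hu
      rw [hBi hh fun _ _ => rfl, hm, ContinuousLinearMap.adjoint_inner_right,
        ← Data.innerWhat_toFun hT.le]
      exact (innerWhat_congr hT.le (memWhat_waveOp hT hu) hf
        ((waveOp_congr hh).trans (hL h)) hk).symm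
    · exact ⟨0, fun h => absurd h hf⟩
  choose Ladj hLadj using key
  exact ⟨Ladj, fun f hf => (hLadj f hf).1, fun u hu f hf => (hLadj f hf).2 u hu⟩

theorem exists_isReproducingKernel (hT : 0 < T) :
    ∃ K, IsReproducingKernel (rect T) (W T) (innerW T) K := by
  obtain ⟨B, hB, hs, hBi⟩ := exists_form_innerW hT
  obtain ⟨M, hM⟩ := isBddOp_solve hT.le
  -- `adjoint M (eval T z)` represents the functional `h ↦ solve h.toFun z`.
  choose m hm using fun z => exists_form_eq_inner hB hs
    (ContinuousLinearMap.adjoint M (Data.eval T z))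
  refine ⟨fun z => solve (m z).toFun, fun z _ => memW_solve hT _, fun z hz u hu => ?_⟩
  obtain ⟨h, hh⟩ := (memW_iff hT).1 hu
  rw [hBi hh fun _ _ => rfl, hm, ContinuousLinearMap.adjoint_inner_right, hh hz, hM h hz,
    real_inner_comm]
  rfl

theorem eq_zero_of_waveOp_eq_zero (hT : 0 < T) {p : ℕ → ℝ × ℝ}
    (hp : ∀ i, p i ∈ rect T) (hdense : rect T ⊆ closure (range p)) {u : ℝ × ℝ → ℝ} (hu : MemW T u)
    (h0 : ∀ i, waveOp T u (p i) = 0) : ∀ q ∈ rect T, u q = 0 := by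
  have hc := (memWhat_waveOp hT hu).continuousOn
  have hz : EqOn (waveOp T u) (fun _ => 0) (rect T) := by
    refine EqOn.of_subset_closure (s := range p) ?_ hc continuousOn_const
      (range_subset_iff.2 hp) hdense
    rintro _ ⟨i, rfl⟩
    exact h0 i
  obtain ⟨h, hh⟩ := (memW_iff hT).1 hu
  intro q hq
  rw [hh hq]
  exact solve_eq_zero_of_waveOp hT (h.toFun_memWhat hT.le)
    (fun z hz' => (waveOp_congr hh hz').symm.trans (hz hz')) q hq

/-- Carries linear combinations of data to linear combinations of functions on the plane, which
agree with `solve` only on `Ω`. -/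
theorem exists_mem_span_eqOn_solve (hT : 0 ≤ T) {ι : Type*} {Ψ : ι → ℝ × ℝ → ℝ} {k : ι → Data T}
    (hk : ∀ i, EqOn (Ψ i) (solve (k i).toFun) (rect T)) {v : Data T}
    (hv : v ∈ Submodule.span ℝ (range k)) :
    ∃ v' ∈ Submodule.span ℝ (range Ψ), EqOn v' (solve v.toFun) (rect T) := by
  obtain ⟨M, hM⟩ := isBddOp_solve hT
  induction hv using Submodule.span_induction with
  | mem v hv =>
    obtain ⟨i, rfl⟩ := hv
    exact ⟨Ψ i, Submodule.subset_span ⟨i, rfl⟩, hk i⟩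
  | zero =>
    refine ⟨0, Submodule.zero_mem _, fun z hz => ?_⟩
    rw [hM _ hz, map_zero]
    simp [Data.toFun]
  | add v w _ _ hv hw =>
    obtain ⟨v', hv', ev⟩ := hv
    obtain ⟨w', hw', ew⟩ := hw
    refine ⟨v' + w', Submodule.add_mem _ hv' hw', fun z hz => ?_⟩
    rw [hM _ hz, map_add, Data.toFun_add, Pi.add_apply, Pi.add_apply, ev hz, ew hz, hM _ hz, hM _ hz]
  | smul r v _ hv =>
    obtain ⟨v', hv', ev⟩ := hv
    refine ⟨r • v', Submodule.smul_mem _ _ hv', fun z hz => ?_⟩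
    rw [hM _ hz, map_smul, Data.toFun_smul, Pi.smul_apply, Pi.smul_apply, ev hz, hM _ hz]

theorem isCompleteSystem_of_orthogonal (hT : 0 < T) {Ψ : ℕ → ℝ × ℝ → ℝ} (hΨ : ∀ i, Ψ i ∈ W T)
    (h0 : ∀ u ∈ W T, (∀ i, innerW T u (Ψ i) = 0) → ∀ q ∈ rect T, u q = 0) :
    IsCompleteSystem T Ψ := by
  refine ⟨hΨ, fun u hu ε hε => ?_, h0⟩
  obtain ⟨B, hB, hs, hBi⟩ := exists_form_innerW hT
  obtain ⟨M, hM⟩ := isBddOp_solve hT.le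
  choose k hk using fun i => (memW_iff hT).1 (hΨ i)
  obtain ⟨h, hh⟩ := (memW_iff hT).1 hu
  have hzero : ∀ h, (∀ i, B h (k i) = 0) → h = 0 := by
    intro h hi
    have hz := h0 _ (memW_solve hT h) fun i => (hBi (fun _ _ => rfl) (hk i)).trans (hi i)
    refine eq_zero_of_form_self hB ?_
    have hz' : EqOn (solve h.toFun) (solve (0 : Data T).toFun) (rect T) := fun q hq => by
      rw [hz q hq, hM _ hq, map_zero]
      simp [Data.toFun]
    rw [← hBi (u := solve h.toFun) (fun _ _ => rfl) (fun _ _ => rfl), hBi hz' (fun _ _ => rfl),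
      map_zero, zero_apply]
  obtain ⟨v, hv, hlt⟩ := exists_mem_span_form_lt hB hs hzero h hε
  obtain ⟨v', hv', ev⟩ := exists_mem_span_eqOn_solve hT.le hk hv
  have e : EqOn (u - v') (solve (h - v).toFun) (rect T) := fun q hq => by
    rw [hM _ hq, map_sub, Data.toFun_sub, Pi.sub_apply, Pi.sub_apply, hh hq, ev hq, hM _ hq,
      hM _ hq]
  exact ⟨v', hv', by rwa [hBi e e]⟩

end SineGordonRK

/-! ### Completeness of `Ψ_i` and the kernel formula -/

theorem theorem3p1 (T : ℝ) (hT : 0 < T) (p : ℕ → ℝ × ℝ)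
    (hp : ∀ i, p i ∈ SineGordonRK.rect T)
    (hdense : SineGordonRK.rect T ⊆ closure (Set.range p)) :
    -- `L` maps `W(Ω)` to `Ŵ(Ω)` and has an adjoint; `W(Ω)` has a reproducing kernel,
    -- and the one of `Ŵ(Ω)` is `G`
    (∀ u ∈ SineGordonRK.W T, SineGordonRK.waveOp T u ∈ SineGordonRK.What T) ∧
    (∃ Ladj, SineGordonRK.IsAdjoint T Ladj) ∧
    (∃ K, SineGordonRK.IsReproducingKernel (SineGordonRK.rect T) (SineGordonRK.W T)
      (SineGordonRK.innerW T) K) ∧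
    SineGordonRK.IsReproducingKernel (SineGordonRK.rect T) (SineGordonRK.What T)
      (SineGordonRK.innerWhat T) SineGordonRK.G ∧
    -- with `Ψ i = L* φ i`, `φ i = G_{p i}`
    ∀ Ladj, SineGordonRK.IsAdjoint T Ladj →
      ∀ K, SineGordonRK.IsReproducingKernel (SineGordonRK.rect T) (SineGordonRK.W T)
          (SineGordonRK.innerW T) K →
        SineGordonRK.IsCompleteSystem T (fun i => Ladj (SineGordonRK.G (p i))) ∧
        ∀ i, ∀ q ∈ SineGordonRK.rect T,
          Ladj (SineGordonRK.G (p i)) q = SineGordonRK.waveOp T (fun z => K z q) (p i) := by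
  have hG := SineGordonRK.isReproducingKernel_G hT.le
  refine ⟨fun u hu => SineGordonRK.memWhat_waveOp hT hu, SineGordonRK.exists_isAdjoint hT,
    SineGordonRK.exists_isReproducingKernel hT, hG, fun Ladj hL K hK => ?_⟩
  have hev : ∀ u ∈ SineGordonRK.W T, ∀ i,
      SineGordonRK.innerW T u (Ladj (SineGordonRK.G (p i))) = SineGordonRK.waveOp T u (p i) :=
    fun u hu i => by
      rw [← hL.2 u hu _ (hG.1 _ (hp i))]
      exact hG.2 _ (hp i) _ (SineGordonRK.memWhat_waveOp hT hu)
  have hΨ : ∀ i, Ladj (SineGordonRK.G (p i)) ∈ SineGordonRK.W T := fun i =>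
    hL.1 _ (hG.1 _ (hp i))
  refine ⟨SineGordonRK.isCompleteSystem_of_orthogonal hT hΨ fun u hu h0 =>
    SineGordonRK.eq_zero_of_waveOp_eq_zero hT hp hdense hu fun i =>
      (hev u hu i).symm.trans (h0 i), fun i q hq => ?_⟩
  -- The formula applies `L` in the index variable of `K`; symmetry of the kernel turns this into
  -- `L` applied to the function `K q` of `W(Ω)`.
  have hsymm : EqOn (K q) (fun z => K z q) (SineGordonRK.rect T) := fun z hz => by
    rw [← hK.2 z hz _ (hK.1 q hq), SineGordonRK.innerW_comm]
    exact hK.2 q hq _ (hK.1 z hz)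
  rw [← SineGordonRK.waveOp_congr hsymm (hp i), ← hev _ (hK.1 q hq) i, SineGordonRK.innerW_comm]
  exact (hK.2 q hq _ (hΨ i)).symm
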